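/- Conventions. For $X,Y\in\mathfrak{gl}_N(\mathbb R)$ put $\langle X,Y\rangle=\operatorname{Tr}(X^{\top}Y)$ and $\|X\|^2=\langle X,X\rangle$. Let $A\subset GL_N(\mathbb R)$ be a split torus over $\mathbb R$ (a linear algebraic group that is algebraically isomorphic to $\mathbb G_m^d$ for some $d$) whose Lie algebra $\mathfrak a$ consists of symmetric matrices. Let $\rho\colon A\to GL(V)$ be an algebraic representation on a finite-dimensional real vector space $V$, let $\pi=D\rho|_e\colon\mathfrak a\to\operatorname{End}(V)$, and let $V$ carry a scalar product for which every $\pi(X)$, $X\in\mathfrak a$, is symmetric. Let $M(A)=X_*(A)\otimes_{\mathbb Z}\mathbb Q$ be the set of classes $\tfrac1n\lambda$ of pairs $(\lambda,n)$ with $\lambda\colon\mathbb G_m\to A$ a cocharacter and $n\in\mathbb N_{>0}$, where $(\lambda,n)\sim(\lambda',n')$ iff $\lambda(t)^{n'}=\lambda'(t)^{n}$ for all $t$. Put $\operatorname{Lie}(\tfrac1n\lambda)=\tfrac1n D\lambda(1)\in\mathfrak a$, and let $q\colon M(A)\to\mathbb Q$ be the quadratic form $q(\tfrac1n\lambda)=\langle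 \tfrac1nD\lambda(1),\tfrac1nD\lambda(1)\rangle$. For $x\in V$ and a cocharacter $\lambda$ let $f(t)=\rho(\lambda(t))x$ for $t\in\mathbb R^\times$. Define $m(x,\lambda)=\infty$ if $x=0$; for $x\neq0$ define $m(x,\lambda)=-\infty$ if $\lim_{t\to0}f(t)$ does not exist, $m(x,\lambda)=0$ if this limit exists and is nonzero, and $m(x,\lambda)=\operatorname{ord}_{t=0}f$ if the limit is $0$. Put $m(x,\tfrac1n\lambda)=\tfrac1n m(x,\lambda)$. Let $q^*_A(x)=\inf\{q(\eta):\eta\in M(A),\ m(x,\eta)\ge1\}$ (with $\inf\varnothing=\infty$) and let $\Lambda_A(x)=\{\eta\in M(A): m(x,\eta)\ge1,\ q(\eta)=q^*_A(x)\}$ be the optimal class of $x$. For $\beta\in\mathfrak a$ let $\pi(\beta)^+=\pi(\beta)-\|\beta\|^2\operatorname{id}_V$, let $V^r_{\pi(\beta)^+}$ be its eigenspace for $r\in\mathbb R$, put $V^{\ge0}_{\pi(\beta)^+}=\bigoplus_{r\ge0}V^r_{\pi(\beta)^+}$, and let $p_\beta\colon V^{\ge0}_{\pi(\beta)^+}\to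 V^0_{\pi(\beta)^+}$ be the orthogonal projection. Let $H_\beta\subset A$ be an algebraic subgroup with Lie algebra $\mathfrak h_\beta=\{X\in\mathfrak a:\langle\beta,X\rangle=0\}$, and put $U^0_{\pi(\beta)^+}=\{v\in V^0_{\pi(\beta)^+}:0\notin\overline{\rho(H_\beta)v}\}$ and $U^{\ge0}_{\pi(\beta)^+}=p_\beta^{-1}(U^0_{\pi(\beta)^+})$. Lemma. Let $\eta\in M(A)$ and $\beta=\operatorname{Lie}(\eta)$. Then $q(\eta)=\|\beta\|^2$ (in particular this number is rational). If moreover $\eta\neq0$, then $$V^{\ge0}_{\pi(\beta)^+}=\{v\in V: m(v,\tfrac{\eta}{q(\eta)})\ge1\},$$ for every $r\in\mathbb R$ every $v\in V^r_{\pi(\beta)^+}\setminus\{0\}$ satisfies $$m(v,\tfrac{\eta}{q(\eta)})=1+\tfrac{r}{q(\eta)}\ \text{ if } r\ge -q(\eta),\qquad m(v,\tfrac{\eta}{q(\eta)})=-\infty\ \text{ if } r<-q(\eta),$$ a subgroup $H_\beta$ as above exists, and for every such $H_\beta$ $$U^{\ge0}_{\pi(\beta)^+}=\{v\in V:\tfrac{\eta}{q(\eta)}\in\Lambda_A(v)\}.$$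 -/

import Mathlib

open Filter Topology
open scoped Matrix MatrixGroups

noncomputable section

namespace HesselinkStrata

/-! ### Linear algebraic groups over `ℝ`, given by their real points -/

/-- The coordinate ring of `GL_N(ℝ)`: polynomials in the matrix entries and in `1 / det`. -/
def regGL (N : ℕ) : Subalgebra ℝ (GL (Fin N) ℝ → ℝ) :=
  Algebra.adjoin ℝ
    ({F | ∃ i j, F = fun g : GL (Fin N) ℝ => (g : Matrix (Fin N) (Fin N) ℝ) i j} ∪
      {fun g : GL (Fin N) ℝ => ((g : Matrix (Fin N) (Fin N) ℝ).det)⁻¹})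

/-- The coordinate ring of `𝔾_m`, with real points `ℝˣ`: Laurent polynomials in `t`. -/
def regGm : Subalgebra ℝ (ℝˣ → ℝ) :=
  Algebra.adjoin ℝ {fun t : ℝˣ => (t : ℝ), fun t : ℝˣ => ((t⁻¹ : ℝˣ) : ℝ)}

/-- The coordinate ring of `𝔾_m ^ d`: Laurent polynomials in `t_1, …, t_d`. -/
def regTorus (d : ℕ) : Subalgebra ℝ ((Fin d → ℝˣ) → ℝ) :=
  Algebra.adjoin ℝ
    ({F | ∃ i, F = fun t => (t i : ℝ)} ∪ {F | ∃ i, F = fun t => (((t i)⁻¹ : ℝˣ) : ℝ)})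

/-- `G` is the zero locus in `GL_N(ℝ)` of a set of polynomial equations. -/
def IsAlgebraicSubgroup {N : ℕ} (G : Subgroup (GL (Fin N) ℝ)) : Prop :=
  ∃ S : Set (GL (Fin N) ℝ → ℝ), S ⊆ regGL N ∧ ∀ g, g ∈ G ↔ ∀ F ∈ S, F g = 0

/-- `A` is a split torus: an algebraic subgroup that is algebraically isomorphic to `𝔾_m ^ d`
for some `d`. -/
def IsSplitTorus {N : ℕ} (A : Subgroup (GL (Fin N) ℝ)) : Prop :=
  IsAlgebraicSubgroup A ∧
    ∃ (d : ℕ) (e : (Fin d → ℝˣ) ≃* A),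
      (∀ i j, (fun t => ((e t : GL (Fin N) ℝ) : Matrix (Fin N) (Fin N) ℝ) i j) ∈ regTorus d) ∧
      (∀ i, ∃ F ∈ regGL N, ∀ a : A, ((e.symm a i : ℝˣ) : ℝ) = F a)

/-- The matrix exponential as an element of `GL_N(ℝ)`. -/
def expGL {N : ℕ} (X : Matrix (Fin N) (Fin N) ℝ) : GL (Fin N) ℝ :=
  ⟨NormedSpace.exp X, NormedSpace.exp (-X),
    by rw [← Matrix.exp_add_of_commute _ _ (Commute.neg_right (Commute.refl X))]; simp,
    by rw [← Matrix.exp_add_of_commute _ _ (Commute.neg_left (Commute.refl X))]; simp⟩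

/-- The Lie algebra of a (closed) subgroup of `GL_N(ℝ)`. -/
def lieAlg {N : ℕ} (G : Subgroup (GL (Fin N) ℝ)) : Set (Matrix (Fin N) (Fin N) ℝ) :=
  {X | ∀ s : ℝ, expGL (s • X) ∈ G}

/-- The scalar product `Tr(Xᵀ Y)` on `𝔤𝔩_N`. -/
def sca {N : ℕ} (X Y : Matrix (Fin N) (Fin N) ℝ) : ℝ := (Xᵀ * Y).trace

/-! ### Algebraic representations and their differentials -/

/-- An algebraic representation of `G ⊆ GL_N(ℝ)` on `V`: all matrix coefficients are given by
polynomial functions in the coordinates of `GL_N`. -/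
structure AlgRep {N : ℕ} (G : Subgroup (GL (Fin N) ℝ)) (V : Type*)
    [AddCommGroup V] [Module ℝ V] where
  toRep : Representation ℝ G V
  regular : ∀ (v : V) (l : Module.Dual ℝ V), ∃ F ∈ regGL N, ∀ g : G, l (toRep g v) = F g

/-- The differential `π = Dρ|_e : 𝔤 → End(V)`, `π(X) = d/ds|_{s=0} ρ(exp(sX))`. -/
def AlgRep.diff {N : ℕ} {G : Subgroup (GL (Fin N) ℝ)} {V : Type*}
    [NormedAddCommGroup V] [InnerProductSpace ℝ V] [FiniteDimensional ℝ V]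
    (ρ : AlgRep G V) (X : lieAlg G) : V →ₗ[ℝ] V :=
  (deriv (fun s : ℝ => LinearMap.toContinuousLinearMap
    (ρ.toRep ⟨expGL (s • (X : Matrix (Fin N) (Fin N) ℝ)), X.2 s⟩)) 0 : V →L[ℝ] V)

/-! ### Cocharacters -/

/-- `X_*(G)`: the algebraic homomorphisms `𝔾_m → G`. -/
structure Cochar {N : ℕ} (G : Subgroup (GL (Fin N) ℝ)) where
  toHom : ℝˣ →* G
  regular : ∀ i j,
    (fun t => ((toHom t : GL (Fin N) ℝ) : Matrix (Fin N) (Fin N) ℝ) i j) ∈ regGm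

/-- A real number as an element of `ℝˣ`; the value at `0` is never relevant. -/
def unitOf (t : ℝ) : ℝˣ := if h : t = 0 then 1 else Units.mk0 t h

lemma unitOf_coe (t : ℝˣ) : unitOf (t : ℝ) = t := by
  ext; simp [unitOf]

lemma coe_unitOf {t : ℝ} (h : t ≠ 0) : ((unitOf t : ℝˣ) : ℝ) = t := by
  simp [unitOf, h]

lemma unitOf_pow {t : ℝ} (h : t ≠ 0) (k : ℕ) : unitOf (t ^ k) = unitOf t ^ k := by
  ext; simp [coe_unitOf, h]

lemma exists_of_mem_regGm {f : ℝˣ → ℝ} (hf : f ∈ regGm) :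
    ∃ (p : Polynomial ℝ) (k : ℕ), ∀ t : ℝˣ, f t * (t : ℝ) ^ k = p.eval (t : ℝ) := by
  induction hf using Algebra.adjoin_induction with
  | mem x hx =>
    rcases hx with rfl | rfl
    · exact ⟨Polynomial.X, 0, fun t => by simp⟩
    · exact ⟨1, 1, fun t => by simp⟩
  | algebraMap r => exact ⟨Polynomial.C r, 0, fun t => by simp⟩
  | add x y _ _ hx hy =>
    obtain ⟨p, k, hp⟩ := hx
    obtain ⟨q, l, hq⟩ := hy
    refine ⟨p * Polynomial.X ^ l + q * Polynomial.X ^ k, k + l, fun t => ?_⟩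
    simp only [Pi.add_apply, Polynomial.eval_add, Polynomial.eval_mul, ← hp, ← hq,
      Polynomial.eval_pow, Polynomial.eval_X]
    ring
  | mul x y _ _ hx hy =>
    obtain ⟨p, k, hp⟩ := hx
    obtain ⟨q, l, hq⟩ := hy
    refine ⟨p * q, k + l, fun t => ?_⟩
    simp only [Pi.mul_apply, Polynomial.eval_mul, ← hp, ← hq]
    ring

lemma pow_mem_regGm {f : ℝˣ → ℝ} (hf : f ∈ regGm) (k : ℤ) : (fun t => f (t ^ k)) ∈ regGm := by
  have ht : (fun t : ℝˣ => (t : ℝ)) ∈ regGm := Algebra.subset_adjoin (Or.inl rfl)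
  have hi : (fun t : ℝˣ => ((t⁻¹ : ℝˣ) : ℝ)) ∈ regGm := Algebra.subset_adjoin (Or.inr rfl)
  have hz : ∀ k : ℤ, (fun t : ℝˣ => ((t ^ k : ℝˣ) : ℝ)) ∈ regGm := by
    intro k
    obtain ⟨n, rfl | rfl⟩ := k.eq_nat_or_neg
    · have := pow_mem ht n
      convert this using 1
      ext t; simp
    · have := pow_mem hi n
      convert this using 1
      ext t; simp
  induction hf using Algebra.adjoin_induction with
  | mem x hx =>
    rcases hx with rfl | rfl
    · exact hz k
    · have := hz (-k)
      convert this using 1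
      ext t; simp
  | algebraMap r => exact regGm.algebraMap_mem r
  | add x y _ _ hx hy => exact add_mem hx hy
  | mul x y _ _ hx hy => exact mul_mem hx hy

/-- A regular function on `𝔾_m` is determined by its values on `k`-th powers. -/
lemma eq_of_pow_eq {f g : ℝˣ → ℝ} (hf : f ∈ regGm) (hg : g ∈ regGm) {k : ℕ} (hk : 0 < k)
    (h : ∀ t, f (t ^ k) = g (t ^ k)) : f = g := by
  obtain ⟨p, m, hp⟩ := exists_of_mem_regGm (sub_mem hf hg)
  have hp0 : p = 0 := by
    apply Polynomial.eq_zero_of_infinite_isRoot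
    apply Set.Infinite.mono _ (Set.Ioi_infinite (0 : ℝ))
    intro x hx
    have hx0 : (0 : ℝ) < x := hx
    have hr : (x ^ ((k : ℝ)⁻¹)) ^ k = x := Real.rpow_inv_natCast_pow hx0.le hk.ne'
    have hr0 : x ^ ((k : ℝ)⁻¹) ≠ 0 := (Real.rpow_pos_of_pos hx0 _).ne'
    have h1 := hp ((Units.mk0 _ hr0) ^ k)
    have h2 := h (Units.mk0 _ hr0)
    simp only [Pi.sub_apply, h2, sub_self, zero_mul, Units.val_pow_eq_pow_val, Units.val_mk0,
      hr] at h1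
    exact h1.symm
  ext t
  have := hp t
  simp only [hp0, Polynomial.eval_zero, Pi.sub_apply] at this
  have h3 := (mul_eq_zero.1 this).resolve_right (pow_ne_zero _ t.ne_zero)
  linarith

namespace Cochar

variable {N : ℕ} {G : Subgroup (GL (Fin N) ℝ)}

/-- The matrix `λ(t)` for a real number `t ≠ 0`. -/
def mat (l : Cochar G) (t : ℝ) : Matrix (Fin N) (Fin N) ℝ :=
  ((l.toHom (unitOf t) : GL (Fin N) ℝ) : Matrix (Fin N) (Fin N) ℝ)

/-- The multiple `k · λ : t ↦ λ(t)^k = λ(t^k)`. -/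
def zmul (k : ℤ) (l : Cochar G) : Cochar G where
  toHom := l.toHom.comp (zpowGroupHom k)
  regular i j := pow_mem_regGm (l.regular i j) k

/-- The derivative `Dλ(1)` of `λ` at `1 ∈ ℝˣ`, applied to the tangent vector `1`. -/
def tangent (l : Cochar G) : Matrix (Fin N) (Fin N) ℝ :=
  Matrix.of fun i j => deriv (fun t : ℝ => l.mat t i j) 1

@[ext] lemma ext' {l l' : Cochar G} (h : ∀ t, l.toHom t = l'.toHom t) : l = l' := by
  cases l; cases l'; congr; exact MonoidHom.ext h

lemma zmul_apply (k : ℤ) (l : Cochar G) (t : ℝˣ) : (zmul k l).toHom t = l.toHom t ^ k := by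
  simp [zmul]

lemma eq_of_zmul_eq {l l' : Cochar G} {k : ℕ} (hk : 0 < k) (h : zmul k l = zmul k l') :
    l = l' := by
  ext1 t
  have key : ∀ i j, (fun t => ((l.toHom t : GL (Fin N) ℝ) : Matrix (Fin N) (Fin N) ℝ) i j) =
      (fun t => ((l'.toHom t : GL (Fin N) ℝ) : Matrix (Fin N) (Fin N) ℝ) i j) := fun i j =>
    eq_of_pow_eq (l.regular i j) (l'.regular i j) hk fun t => by
      have h1 := congrArg (fun c : Cochar G => c.toHom t) h
      simp only [zmul_apply, zpow_natCast, ← map_pow] at h1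
      rw [h1]
  apply Subtype.ext
  apply Units.ext
  ext i j
  exact congrFun (key i j) t

lemma zmul_zmul (a b : ℤ) (l : Cochar G) : zmul a (zmul b l) = zmul (a * b) l := by
  ext1 t
  rw [zmul_apply, zmul_apply, zmul_apply, ← zpow_mul, mul_comm]

end Cochar

/-! ### The set `M(G)` of rational cocharacters -/

/-- `(λ, n) ∼ (λ', n')` if and only if `n' · λ = n · λ'`. -/
instance fracSetoid {N : ℕ} (G : Subgroup (GL (Fin N) ℝ)) : Setoid (Cochar G × ℕ+) where
  r a b := Cochar.zmul (b.2 : ℕ) a.1 = Cochar.zmul (a.2 : ℕ) b.1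
  iseqv :=
    { refl := fun _ => rfl
      symm := fun h => h.symm
      trans := by
        rintro ⟨l, n⟩ ⟨l', n'⟩ ⟨l'', n''⟩ h h'
        apply Cochar.eq_of_zmul_eq n'.pos
        simp only [] at h h' ⊢
        rw [Cochar.zmul_zmul, mul_comm, ← Cochar.zmul_zmul, h, Cochar.zmul_zmul,
          mul_comm, ← Cochar.zmul_zmul, h', Cochar.zmul_zmul, Cochar.zmul_zmul, mul_comm] }

/-- `M(G)`: the set of classes `(1/n) λ` with `λ ∈ X_*(G)` and `n > 0`.
For a split torus `A` it is `X_*(A) ⊗ ℚ`. -/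
def M {N : ℕ} (G : Subgroup (GL (Fin N) ℝ)) : Type := Quotient (fracSetoid G)

namespace M

variable {N : ℕ} {G : Subgroup (GL (Fin N) ℝ)}

/-- The class `(1/n) λ`. -/
def mk (l : Cochar G) (n : ℕ+) : M G := Quotient.mk (fracSetoid G) (l, n)

/-- `r · (1/n) λ = (1/(b n)) (a λ)` for `r = a / b`. -/
instance : SMul ℚ (M G) where
  smul r := Quotient.map'
    (fun x => (Cochar.zmul r.num x.1, r.pnatDen * x.2))
    (by
      rintro ⟨l, n⟩ ⟨l', n'⟩ h
      have h1 : Cochar.zmul (n' : ℕ) l = Cochar.zmul (n : ℕ) l' := h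
      change Cochar.zmul _ _ = Cochar.zmul _ _
      have e : ∀ (m : ℕ) (c : Cochar G), Cochar.zmul ((r.den : ℤ) * m) (Cochar.zmul r.num c) =
          Cochar.zmul (r.den * r.num) (Cochar.zmul m c) := fun m c => by
        rw [Cochar.zmul_zmul, Cochar.zmul_zmul]; congr 1; ring
      have e' : ∀ m : ℕ+, (((r.pnatDen * m : ℕ+) : ℕ) : ℤ) =
          (r.den : ℤ) * ((m : ℕ) : ℤ) := fun m => by simp
      simp only []
      rw [e' n', e' n, e, e, h1])

/-- The class of the trivial cocharacter. -/
instance : Zero (M G) := ⟨mk ⟨1, fun i j => by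
  have := regGm.algebraMap_mem ((1 : Matrix (Fin N) (Fin N) ℝ) i j)
  convert this using 1
  ext t
  simp⟩ 1⟩

end M

/-! ### The embedding `Lie : M(G) → 𝔤` -/

namespace Cochar

variable {N : ℕ} {G : Subgroup (GL (Fin N) ℝ)}

lemma mat_mul (l : Cochar G) {s t : ℝ} (hs : s ≠ 0) (ht : t ≠ 0) :
    l.mat (s * t) = l.mat s * l.mat t := by
  have : unitOf (s * t) = unitOf s * unitOf t := by
    ext; simp [coe_unitOf, hs, ht]
  simp [mat, this]

lemma mat_one (l : Cochar G) : l.mat 1 = 1 := by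
  have : unitOf 1 = 1 := by ext; simp [unitOf]
  simp [mat, this]

lemma differentiableAt_mat (l : Cochar G) (i j : Fin N) :
    DifferentiableAt ℝ (fun t : ℝ => l.mat t i j) 1 := by
  obtain ⟨p, k, hp⟩ := exists_of_mem_regGm (l.regular i j)
  have h1 : DifferentiableAt ℝ (fun t : ℝ => p.eval t / t ^ k) 1 :=
    p.differentiable.differentiableAt.div (by fun_prop) (by simp)
  refine h1.congr_of_eventuallyEq ?_
  filter_upwards [isOpen_ne.mem_nhds (one_ne_zero : (1 : ℝ) ≠ 0)] with t ht
  have := hp (unitOf t)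
  rw [coe_unitOf ht] at this
  rw [← this]
  simp only [mat]
  field_simp [pow_ne_zero k ht]

lemma hasDerivAt_mat (l : Cochar G) (i j : Fin N) :
    HasDerivAt (fun t : ℝ => l.mat t i j) (l.tangent i j) 1 :=
  (l.differentiableAt_mat i j).hasDerivAt

lemma hasDerivAt_mat_exp (l : Cochar G) (s : ℝ) (i j : Fin N) :
    HasDerivAt (fun s : ℝ => l.mat (Real.exp s) i j) ((l.mat (Real.exp s) * l.tangent) i j) s := by
  have h1 : HasDerivAt (fun u : ℝ => Real.exp (u - s)) 1 s := by
    simpa using ((hasDerivAt_id s).sub_const s).exp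
  have h2 : ∀ r, HasDerivAt (fun u : ℝ => l.mat (Real.exp (u - s)) r j) (l.tangent r j) s := by
    intro r
    have h3 : HasDerivAt (fun t : ℝ => l.mat t r j) (l.tangent r j) (Real.exp (s - s)) := by
      simpa using l.hasDerivAt_mat r j
    have h4 := h3.comp s h1
    rw [mul_one] at h4
    exact h4
  have h4 : HasDerivAt (fun u : ℝ => ∑ r, l.mat (Real.exp s) i r * l.mat (Real.exp (u - s)) r j)
      (∑ r, l.mat (Real.exp s) i r * l.tangent r j) s :=
    HasDerivAt.fun_sum fun r _ => (h2 r).const_mul _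
  rw [Matrix.mul_apply]
  convert h4 using 1
  ext u
  rw [← Matrix.mul_apply, ← l.mat_mul (Real.exp_ne_zero _) (Real.exp_ne_zero _), ← Real.exp_add]
  congr 2
  ring_nf

open scoped Matrix.Norms.Operator in
lemma mat_exp (l : Cochar G) (s : ℝ) :
    l.mat (Real.exp s) = NormedSpace.exp (s • l.tangent) := by
  have hm : ∀ s, HasDerivAt (fun s : ℝ => l.mat (Real.exp s)) (l.mat (Real.exp s) * l.tangent) s :=
    fun s => hasDerivAt_pi.2 fun i => hasDerivAt_pi.2 fun j => l.hasDerivAt_mat_exp s i j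
  have he : ∀ s : ℝ, HasDerivAt (fun s : ℝ => NormedSpace.exp (s • (-l.tangent)))
      ((-l.tangent) * NormedSpace.exp (s • (-l.tangent))) s :=
    fun s => hasDerivAt_exp_smul_const' _ s
  have hc : ∀ s, HasDerivAt
      (fun s : ℝ => l.mat (Real.exp s) * NormedSpace.exp (s • (-l.tangent))) 0 s := by
    intro s
    have := (hm s).mul (he s)
    have h0 : l.mat (Real.exp s) * l.tangent * NormedSpace.exp (s • (-l.tangent)) +
        l.mat (Real.exp s) * ((-l.tangent) * NormedSpace.exp (s • (-l.tangent))) = 0 := by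
      rw [neg_mul, mul_neg, mul_assoc, add_neg_cancel]
    rw [h0] at this
    exact this
  have hconst := is_const_of_deriv_eq_zero (fun s => (hc s).differentiableAt)
    (fun s => (hc s).deriv) s 0
  rw [Real.exp_zero, mat_one, zero_smul, NormedSpace.exp_zero, mul_one] at hconst
  have hinv : NormedSpace.exp (s • (-l.tangent)) * NormedSpace.exp (s • l.tangent) = 1 := by
    rw [smul_neg]
    exact (expGL (s • l.tangent)).inv_val
  calc l.mat (Real.exp s)
      = l.mat (Real.exp s) * (NormedSpace.exp (s • (-l.tangent)) *
          NormedSpace.exp (s • l.tangent)) := by rw [hinv, mul_one]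
    _ = NormedSpace.exp (s • l.tangent) := by rw [← mul_assoc, hconst, one_mul]

lemma smul_tangent_mem (l : Cochar G) (c : ℝ) : c • l.tangent ∈ lieAlg G := by
  intro s
  have : expGL (s • c • l.tangent) = (l.toHom (unitOf (Real.exp (s * c))) : GL (Fin N) ℝ) := by
    apply Units.ext
    change NormedSpace.exp (s • c • l.tangent) = l.mat (Real.exp (s * c))
    rw [mat_exp, smul_smul]
  rw [this]
  exact (l.toHom _).2

lemma tangent_zmul (k : ℕ) (l : Cochar G) : (zmul k l).tangent = (k : ℝ) • l.tangent := by
  ext i j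
  rw [Matrix.smul_apply, smul_eq_mul]
  refine HasDerivAt.unique ((zmul k l).hasDerivAt_mat i j) ?_
  have h1 : HasDerivAt (fun t : ℝ => t ^ k) (k : ℝ) 1 := by
    simpa using hasDerivAt_pow k (1 : ℝ)
  have h2 : HasDerivAt (fun t : ℝ => l.mat t i j) (l.tangent i j) (1 ^ k) := by
    simpa using l.hasDerivAt_mat i j
  have h3 : HasDerivAt (fun t : ℝ => l.mat (t ^ k) i j) (l.tangent i j * (k : ℝ)) 1 :=
    h2.comp 1 h1
  rw [mul_comm] at h3
  refine h3.congr_of_eventuallyEq ?_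
  filter_upwards [isOpen_ne.mem_nhds (one_ne_zero : (1 : ℝ) ≠ 0)] with t ht
  simp [mat, zmul, unitOf_pow ht]

end Cochar

namespace M

variable {N : ℕ} {G : Subgroup (GL (Fin N) ℝ)}

/-- `Lie : M(G) → 𝔤`, `(1/n) λ ↦ Dλ(1/n) = (1/n) Dλ(1)`. -/
def lie : M G → lieAlg G :=
  Quotient.lift (fun x => ⟨((x.2 : ℕ) : ℝ)⁻¹ • x.1.tangent, x.1.smul_tangent_mem _⟩) (by
    rintro ⟨l, n⟩ ⟨l', n'⟩ h
    have h1 : Cochar.zmul (n' : ℕ) l = Cochar.zmul (n : ℕ) l' := h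
    have h2 := congrArg Cochar.tangent h1
    rw [Cochar.tangent_zmul, Cochar.tangent_zmul] at h2
    have hn : ((n : ℕ) : ℝ) ≠ 0 := by exact_mod_cast n.ne_zero
    have hn' : ((n' : ℕ) : ℝ) ≠ 0 := by exact_mod_cast n'.ne_zero
    apply Subtype.ext
    simp only []
    rw [inv_smul_eq_iff₀ hn, smul_comm, eq_comm, inv_smul_eq_iff₀ hn', h2])

open Classical in
/-- The quadratic form `q : M(A) → ℚ`, `q((1/n) λ) = ⟨Dλ(1/n), Dλ(1/n)⟩`: the rational number
that is equal to this real number. (For a split torus `A` with `Lie A` consisting of symmetric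
matrices there always is one; otherwise the value `0` is used.) -/
def q (η : M G) : ℚ :=
  if h : ∃ r : ℚ, (r : ℝ) = sca (lie η : Matrix (Fin N) (Fin N) ℝ) (lie η) then h.choose else 0

end M

/-! ### The measure of instability -/

section Instability

variable {N : ℕ} {G : Subgroup (GL (Fin N) ℝ)} {V : Type*}
  [NormedAddCommGroup V] [InnerProductSpace ℝ V]

/-- The function `f : ℝˣ → V`, `f(t) = λ(t) · x`. Only its values at `t ≠ 0` are used. -/
def orbitFun (ρ : AlgRep G V) (x : V) (l : Cochar G) (t : ℝ) : V :=
  ρ.toRep (l.toHom (unitOf t)) x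

open Classical in
/-- The measure of instability `m(x, λ)` for `λ ∈ X_*(G)`: it is `∞` for `x = 0`; otherwise
`-∞` if `lim_{t → 0} f(t)` does not exist, `0` if the limit exists and is not zero, and the order
of vanishing of `f` at `t = 0` if the limit is zero. -/
def instabCochar (ρ : AlgRep G V) (x : V) (l : Cochar G) : EReal :=
  if x = 0 then ⊤
  else if ¬ ∃ y, Tendsto (orbitFun ρ x l) (𝓝[≠] 0) (𝓝 y) then ⊥
  else if ¬ Tendsto (orbitFun ρ x l) (𝓝[≠] 0) (𝓝 0) then 0
  else (((meromorphicOrderAt (orbitFun ρ x l) 0).untopD 0 : ℤ) : ℝ)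

lemma regGL_comp {F : GL (Fin N) ℝ → ℝ} (hF : F ∈ regGL N) (l : Cochar G) :
    (fun t : ℝˣ => F (l.toHom t)) ∈ regGm := by
  have hdet : ∀ c : Cochar G, (fun t : ℝˣ =>
      ((c.toHom t : GL (Fin N) ℝ) : Matrix (Fin N) (Fin N) ℝ).det) ∈ regGm := by
    intro c
    simp only [Matrix.det_apply]
    have : (fun t : ℝˣ => ∑ σ : Equiv.Perm (Fin N), Equiv.Perm.sign σ •
        ∏ i, ((c.toHom t : GL (Fin N) ℝ) : Matrix (Fin N) (Fin N) ℝ) (σ i) i) =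
        ∑ σ : Equiv.Perm (Fin N), ((Equiv.Perm.sign σ : ℤ) : ℝ) •
        ∏ i, fun t : ℝˣ => ((c.toHom t : GL (Fin N) ℝ) : Matrix (Fin N) (Fin N) ℝ) (σ i) i := by
      ext t
      simp [Finset.sum_apply, Finset.prod_apply, Units.smul_def]
    rw [this]
    exact sum_mem fun σ _ => regGm.smul_mem (prod_mem fun i _ => c.regular _ _) _
  induction hF using Algebra.adjoin_induction with
  | mem x hx =>
    rcases hx with ⟨i, j, rfl⟩ | hx
    · exact l.regular i j
    · rw [Set.mem_singleton_iff] at hx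
      subst hx
      convert hdet (Cochar.zmul (-1) l) using 1
      ext t
      rw [Cochar.zmul_apply]
      simp [Matrix.coe_units_inv, Matrix.det_nonsing_inv]
  | algebraMap r => exact regGm.algebraMap_mem r
  | add x y _ _ hx hy => exact add_mem hx hy
  | mul x y _ _ hx hy => exact mul_mem hx hy

lemma meromorphicAt_of_mem_regGm {f : ℝˣ → ℝ} (hf : f ∈ regGm) :
    MeromorphicAt (fun t : ℝ => f (unitOf t)) 0 := by
  obtain ⟨p, k, hp⟩ := exists_of_mem_regGm hf
  have hpa : AnalyticAt ℝ (fun t : ℝ => p.eval t) 0 := by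
    have h := AnalyticAt.aeval_polynomial (analyticAt_id (𝕜 := ℝ) (z := (0 : ℝ))) p
    simp only [id, Polynomial.coe_aeval_eq_eval] at h
    exact h
  have h1 : MeromorphicAt (fun t : ℝ => p.eval t / t ^ k) 0 :=
    hpa.meromorphicAt.fun_div (analyticAt_id.pow k).meromorphicAt
  refine h1.congr ?_
  filter_upwards [self_mem_nhdsWithin] with t ht
  have ht : t ≠ 0 := ht
  have := hp (unitOf t)
  rw [coe_unitOf ht] at this
  rw [← this]
  field_simp [pow_ne_zero k ht]

lemma orbitFun_ne_zero (ρ : AlgRep G V) {x : V} (hx : x ≠ 0) (l : Cochar G) (t : ℝ) :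
    orbitFun ρ x l t ≠ 0 := by
  intro h
  apply hx
  have := congrArg (ρ.toRep (l.toHom (unitOf t))⁻¹) h
  simpa [orbitFun] using this

variable [FiniteDimensional ℝ V]

lemma meromorphicAt_orbitFun (ρ : AlgRep G V) (x : V) (l : Cochar G) :
    MeromorphicAt (orbitFun ρ x l) 0 := by
  let b := Module.finBasis ℝ V
  have h : orbitFun ρ x l = fun t => ∑ i, b.repr (orbitFun ρ x l t) i • b i := by
    ext t; rw [b.sum_repr]
  rw [h]
  refine MeromorphicAt.fun_sum fun i _ => ?_
  refine MeromorphicAt.fun_smul (𝕜 := ℝ) (f := fun t => b.repr (orbitFun ρ x l t) i)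
    (g := fun _ => b i) ?_ (MeromorphicAt.const _ _)
  obtain ⟨F, hF, hFl⟩ := ρ.regular x (b.coord i)
  have := meromorphicAt_of_mem_regGm (regGL_comp hF l)
  have e : (fun t : ℝ => b.repr (orbitFun ρ x l t) i) =
      fun t : ℝ => F ((l.toHom (unitOf t) : G) : GL (Fin N) ℝ) := funext fun t => hFl _
  rw [e]
  exact this

lemma exists_order (ρ : AlgRep G V) {x : V} (hx : x ≠ 0) (l : Cochar G) :
    ∃ n : ℤ, meromorphicOrderAt (orbitFun ρ x l) 0 = n ∧
      instabCochar ρ x l = if n < 0 then ⊥ else ((n : ℝ) : EReal) := by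
  have hm := meromorphicAt_orbitFun ρ x l
  have htop : meromorphicOrderAt (orbitFun ρ x l) 0 ≠ ⊤ := by
    rw [meromorphicOrderAt_ne_top_iff_eventually_ne_zero hm]
    exact Eventually.of_forall fun t => orbitFun_ne_zero ρ hx l t
  obtain ⟨n, hn⟩ := WithTop.ne_top_iff_exists.1 htop
  refine ⟨n, hn.symm, ?_⟩
  unfold instabCochar
  rw [tendsto_nhds_iff_meromorphicOrderAt_nonneg hm, tendsto_zero_iff_meromorphicOrderAt_pos hm,
    ← hn, if_neg hx]
  rw [← WithTop.coe_zero, WithTop.coe_le_coe, WithTop.coe_lt_coe]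
  rcases lt_trichotomy n 0 with h | h | h
  · simp [h]
  · simp [h]
  · simp [h, h.le, not_lt.2 h.le]

lemma instabCochar_zmul (ρ : AlgRep G V) (x : V) (l : Cochar G) (k : ℕ) (hk : 0 < k) :
    instabCochar ρ x (Cochar.zmul k l) = ((k : ℝ) : EReal) * instabCochar ρ x l := by
  have hkr : (0 : ℝ) < k := by exact_mod_cast hk
  by_cases hx : x = 0
  · rw [instabCochar, instabCochar, if_pos hx, if_pos hx, EReal.coe_mul_top_of_pos hkr]
  obtain ⟨n, hn, hn'⟩ := exists_order ρ hx l
  obtain ⟨m, hm, hm'⟩ := exists_order ρ hx (Cochar.zmul k l)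
  have hmn : m = k * n := by
    have h1 := (meromorphicOrderAt_eq_int_iff (meromorphicAt_orbitFun ρ x l)).1 hn
    obtain ⟨g, hg, hg0, hge⟩ := h1
    have h2 : meromorphicOrderAt (orbitFun ρ x (Cochar.zmul k l)) 0 = ((k * n : ℤ) : WithTop ℤ) := by
      rw [meromorphicOrderAt_eq_int_iff (meromorphicAt_orbitFun ρ x _)]
      refine ⟨fun t => g (t ^ k), ?_, ?_, ?_⟩
      · refine AnalyticAt.fun_comp (f := fun t : ℝ => t ^ k) (g := g) ?_ (analyticAt_id.pow k)
        simpa [hk.ne'] using hg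
      · simpa [hk.ne'] using hg0
      · have ht : Tendsto (fun t : ℝ => t ^ k) (𝓝[≠] 0) (𝓝[≠] 0) := by
          refine tendsto_nhdsWithin_iff.2 ⟨?_, ?_⟩
          · have : Tendsto (fun t : ℝ => t ^ k) (𝓝 0) (𝓝 (0 ^ k)) :=
              (continuous_pow k).tendsto 0
            rw [zero_pow hk.ne'] at this
            exact this.mono_left nhdsWithin_le_nhds
          · filter_upwards [self_mem_nhdsWithin] with t ht
            exact pow_ne_zero k ht
        filter_upwards [ht.eventually hge, self_mem_nhdsWithin] with t h3 ht0
        have ht0 : t ≠ 0 := ht0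
        have h4 : orbitFun ρ x (Cochar.zmul k l) t = orbitFun ρ x l (t ^ k) := by
          simp [orbitFun, Cochar.zmul, unitOf_pow ht0]
        rw [h4, h3]
        simp [_root_.zpow_mul]
    rw [hm] at h2
    exact_mod_cast h2
  rw [hm', hn', hmn]
  by_cases h : n < 0
  · have : (k : ℤ) * n < 0 := mul_neg_of_pos_of_neg (by exact_mod_cast hk) h
    rw [if_pos h, if_pos this, EReal.coe_mul_bot_of_pos hkr]
  · have : ¬ (k : ℤ) * n < 0 := not_lt.2 (mul_nonneg (by positivity) (not_lt.1 h))
    simp [h, this]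

/-- `m(x, (1/n) λ) = (1/n) m(x, λ)`. -/
def instab (ρ : AlgRep G V) (x : V) : M G → EReal :=
  Quotient.lift (fun a => ((((a.2 : ℕ) : ℝ)⁻¹ : ℝ) : EReal) * instabCochar ρ x a.1) (by
    rintro ⟨l, n⟩ ⟨l', n'⟩ h
    have h1 : Cochar.zmul (n' : ℕ) l = Cochar.zmul (n : ℕ) l' := h
    have h2 := congrArg (instabCochar ρ x) h1
    rw [instabCochar_zmul _ _ _ _ n'.pos, instabCochar_zmul _ _ _ _ n.pos] at h2
    have hn : ((n : ℕ) : ℝ) ≠ 0 := by exact_mod_cast n.ne_zero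
    have hn' : ((n' : ℕ) : ℝ) ≠ 0 := by exact_mod_cast n'.ne_zero
    have h3 := congrArg (fun y : EReal =>
      (((((n : ℕ) : ℝ)⁻¹ * ((n' : ℕ) : ℝ)⁻¹ : ℝ)) : EReal) * y) h2
    simp only [← mul_assoc, ← EReal.coe_mul] at h3 ⊢
    rw [inv_mul_cancel_right₀ hn', mul_right_comm, inv_mul_cancel₀ hn, one_mul] at h3
    exact h3)

/-- `q*_A(x) = inf { q(η) : η ∈ M(A), m(x, η) ≥ 1 }`, which is `∞` if there is no such `η`. -/
def qStar (ρ : AlgRep G V) (x : V) : EReal :=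
  ⨅ (η : M G) (_ : 1 ≤ instab ρ x η), ((M.q η : ℝ) : EReal)

/-- Hesselink's optimal class `Λ_A(x)`. -/
def optimalClass (ρ : AlgRep G V) (x : V) : Set (M G) :=
  {η | 1 ≤ instab ρ x η ∧ ((M.q η : ℝ) : EReal) = qStar ρ x}

/-! ### The sets `V^{≥ 0}` and `U^{≥ 0}` -/

/-- `π(β)⁺ = π(β) - ‖β‖² · id_V`. -/
def piPlus (ρ : AlgRep G V) (β : lieAlg G) : Module.End ℝ V :=
  ρ.diff β - sca (β : Matrix (Fin N) (Fin N) ℝ) β • LinearMap.id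

/-- The eigenspace `V^r_{π(β)⁺}`. -/
def eigV (ρ : AlgRep G V) (β : lieAlg G) (r : ℝ) : Submodule ℝ V :=
  Module.End.eigenspace (piPlus ρ β) r

/-- `V^{≥ 0}_{π(β)⁺}`, the sum of the eigenspaces for the eigenvalues `r ≥ 0`. -/
def nonnegV (ρ : AlgRep G V) (β : lieAlg G) : Submodule ℝ V :=
  ⨆ (r : ℝ) (_ : 0 ≤ r), eigV ρ β r

/-- For a split torus `A` (for which `𝔨 = 0` and `𝔭 = 𝔤 = Lie A`, and which centralizes `β`):
`H` is an algebraic subgroup of `A` with Lie algebra `𝔥_β = {X ∈ Lie A : ⟨β, X⟩ = 0}`. -/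
def IsHBeta (A : Subgroup (GL (Fin N) ℝ)) (β : lieAlg A) (H : Subgroup (GL (Fin N) ℝ)) : Prop :=
  H ≤ A ∧ IsAlgebraicSubgroup H ∧
    lieAlg H = {X | X ∈ lieAlg A ∧ sca (β : Matrix (Fin N) (Fin N) ℝ) X = 0}

/-- `U^0_{π(β)⁺}`: the vectors `v ∈ V^0_{π(β)⁺}` with `0` not in the closure of `H · v`. -/
def semistable (ρ : AlgRep G V) (β : lieAlg G) (H : Subgroup (GL (Fin N) ℝ)) : Set V :=
  {v | v ∈ eigV ρ β 0 ∧ (0 : V) ∉ closure {w | ∃ h : G, (h : GL (Fin N) ℝ) ∈ H ∧ w = ρ.toRep h v}}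

/-- `U^{≥ 0}_{π(β)⁺}`: the preimage of `U^0_{π(β)⁺}` under the orthogonal projection
`V^{≥ 0}_{π(β)⁺} → V^0_{π(β)⁺}`. -/
def nonnegU (ρ : AlgRep G V) (β : lieAlg G) (H : Subgroup (GL (Fin N) ℝ)) : Set V :=
  {v | v ∈ nonnegV ρ β ∧ (eigV ρ β 0).starProjection v ∈ semistable ρ β H}

end Instability

end HesselinkStrata

end

open HesselinkStrata

noncomputable section

namespace HesselinkStrata

/-! ### One-parameter groups -/

/-! The operators `π(X)` commute and are symmetric, so `V` has a basis of common eigenvectors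
(`exists_weightBasis`). A cocharacter acts on each basis vector by an integral power of `t`
(`exists_zpow`), so `m(v, η)` is the smallest weight of `Lie η` on the support of `v`, or `-∞` if
that weight is negative (`exists_instab`). Thus `m(v, η) ≥ 1` is a system of linear inequalities on
`Lie η`. Since `η / q(η)` has Lie vector `β / ‖β‖²`, this gives the description of `V^{≥ 0}` and the
values on eigenspaces.

Applied to `ℝ ^ N`, the same weights write the scalar product as a sum of products of forms that are
integral on cocharacters (`exists_sca_eq_sum`). Hence `q` is rational, and `⟨β, ·⟩` is a rational
multiple of the differential of an algebraic character, whose kernel serves as `H_β`.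

For the last equality, let `v ∈ V^{≥ 0}`. Optimality says that `β / ‖β‖²` has least norm among the
rational points of the polyhedron on which all weights in the support of `v` are at least `1`. The
constraints active at this point are the weights in the support of `p_β(v)`. A shorter rational
point exists if and only if some direction orthogonal to `β` is positive on all active weights
(`exists_direction_of_lt`, `exists_rat_lt_of_direction`). By the Hilbert-Mumford criterion for `H_β`
(`zero_mem_closure_iff`), such a direction exists if and only if `0` lies in the closure of `H_β
p_β(v)`. -/

lemma eq_exp_smul_of_hasDerivAt {W : Type*} [NormedAddCommGroup W] [NormedSpace ℝ W] {u : ℝ → W}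
    {c : ℝ} (h : ∀ s, HasDerivAt u (c • u s) s) (s : ℝ) : u s = Real.exp (s * c) • u 0 := by
  have hd : ∀ s, HasDerivAt (fun s => Real.exp (-(s * c)) • u s) 0 s := by
    intro s
    have h1 : HasDerivAt (fun s : ℝ => Real.exp (-(s * c))) (Real.exp (-(s * c)) * -c) s := by
      simpa using (((hasDerivAt_id s).mul_const c).neg).exp
    have h2 := h1.smul (h s)
    rwa [smul_smul, ← add_smul, mul_neg, add_neg_cancel, zero_smul] at h2
  have hconst := is_const_of_deriv_eq_zero (fun s => (hd s).differentiableAt)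
    (fun s => (hd s).deriv) s 0
  simp only [zero_mul, neg_zero, Real.exp_zero, one_smul] at hconst
  rw [← hconst, smul_smul, ← Real.exp_add, add_neg_cancel, Real.exp_zero, one_smul]

section OneParameter

variable {𝔸 : Type*} [NormedRing 𝔸] [NormedAlgebra ℝ 𝔸] {φ : ℝ → 𝔸} {D : 𝔸}

lemma hasDerivAt_of_map_add (hadd : ∀ s t, φ (s + t) = φ s * φ t) (hD : HasDerivAt φ D 0) (s : ℝ) :
    HasDerivAt φ (φ s * D) s := by
  have h2 : HasDerivAt φ D (s - s) := by simpa using hD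
  have h3 : HasDerivAt (fun u => φ (u - s)) D s := h2.comp_sub_const s s
  refine (h3.const_mul (φ s)).congr_of_eventuallyEq (Eventually.of_forall fun u => ?_)
  simp only [← hadd, add_sub_cancel]

lemma eq_exp_of_map_add [CompleteSpace 𝔸] (h0 : φ 0 = 1)
    (hadd : ∀ s t, φ (s + t) = φ s * φ t) (hD : HasDerivAt φ D 0) (s : ℝ) :
    φ s = NormedSpace.exp (s • D) := by
  have hinv : ∀ s : ℝ, NormedSpace.exp (s • (-D)) * NormedSpace.exp (s • D) = 1 := fun s => by
    have hcomm : Commute (s • (-D)) (s • D) :=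
      ((Commute.refl D).neg_left.smul_left s).smul_right s
    let _ : NormedAlgebra ℚ 𝔸 := NormedAlgebra.restrictScalars ℚ ℝ 𝔸
    rw [← NormedSpace.exp_add_of_commute hcomm]
    simp
  have hc : ∀ s, HasDerivAt (fun s : ℝ => φ s * NormedSpace.exp (s • (-D))) 0 s := by
    intro s
    have := (hasDerivAt_of_map_add hadd hD s).mul (hasDerivAt_exp_smul_const' (𝕂 := ℝ) (-D) s)
    rwa [neg_mul, mul_neg, mul_assoc, add_neg_cancel] at this
  have hconst := is_const_of_deriv_eq_zero (fun s => (hc s).differentiableAt)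
    (fun s => (hc s).deriv) s 0
  simp only [zero_smul, NormedSpace.exp_zero, mul_one, h0] at hconst
  calc φ s = φ s * (NormedSpace.exp (s • (-D)) * NormedSpace.exp (s • D)) := by rw [hinv, mul_one]
    _ = _ := by rw [← mul_assoc, hconst, one_mul]

end OneParameter

/-! ### Exponential polynomials -/

/-- The characters `s ↦ exp (c s)` of `ℝ`. -/
def expChar : Multiplicative ℝ →* (ℝ → ℝ) where
  toFun c s := Real.exp (s * c.toAdd)
  map_one' := by ext; simp
  map_mul' a b := by ext; simp [mul_add, Real.exp_add]

/-- The algebra of functions `s ↦ ∑ a_c exp (c s)`. -/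
def expPoly : Subalgebra ℝ (ℝ → ℝ) := (AddMonoidAlgebra.lift ℝ (ℝ → ℝ) ℝ expChar).range

lemma exp_mem_expPoly (c : ℝ) : (fun s => Real.exp (s * c)) ∈ expPoly :=
  ⟨AddMonoidAlgebra.single c 1, by
    rw [AlgHom.toRingHom_eq_coe, RingHom.coe_coe, AddMonoidAlgebra.lift_single, one_smul]; rfl⟩

lemma exists_of_mem_expPoly {f : ℝ → ℝ} (hf : f ∈ expPoly) :
    ∃ p : ℝ →₀ ℝ, ∀ s, f s = ∑ c ∈ p.support, p c * Real.exp (s * c) := by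
  obtain ⟨p, rfl⟩ := hf
  refine ⟨p.coeff, fun s => ?_⟩
  rw [AlgHom.toRingHom_eq_coe, RingHom.coe_coe, AddMonoidAlgebra.lift_apply, Finsupp.sum,
    Finset.sum_apply]
  rfl

lemma differentiable_of_mem_expPoly {f : ℝ → ℝ} (hf : f ∈ expPoly) : Differentiable ℝ f := by
  obtain ⟨p, hp⟩ := exists_of_mem_expPoly hf
  rw [funext hp]
  fun_prop

lemma comp_neg_mem_expPoly {f : ℝ → ℝ} (hf : f ∈ expPoly) : (fun s => f (-s)) ∈ expPoly := by
  obtain ⟨p, hp⟩ := exists_of_mem_expPoly hf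
  have : (fun s => f (-s)) = ∑ c ∈ p.support, p c • fun s => Real.exp (s * -c) := by
    ext s
    simp [hp]
  rw [this]
  exact sum_mem fun c _ => expPoly.smul_mem (exp_mem_expPoly _) _

/-- Distinct `c` give distinct characters `n ↦ exp (c n)` of the monoid `ℕ`, and distinct characters
are linearly independent. -/
lemma eq_zero_of_mem_expPoly {f : ℝ → ℝ} (hf : f ∈ expPoly) (h : ∀ n : ℕ, f n = 0) : f = 0 := by
  obtain ⟨p, hp⟩ := exists_of_mem_expPoly hf
  let ψ : ℝ → (Multiplicative ℕ →* ℝ) := fun c =>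
    { toFun := fun n => Real.exp ((n.toAdd : ℝ) * c)
      map_one' := by simp
      map_mul' := fun a b => by simp [add_mul, Real.exp_add] }
  have hψ : Function.Injective ψ := fun a b hab => by
    have := DFunLike.congr_fun hab (Multiplicative.ofAdd 1)
    simpa [ψ] using this
  have hl := (linearIndependent_monoidHom (Multiplicative ℕ) ℝ).comp ψ hψ
  have hz : ∀ c ∈ p.support, p c = 0 := by
    refine linearIndependent_iff'.1 hl p.support p ?_
    ext n
    have h1 := h n.toAdd
    rw [hp] at h1
    simpa [ψ, Finset.sum_apply] using h1
  ext s
  rw [hp, Finset.sum_eq_zero fun c hc => by rw [hz c hc, zero_mul]]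
  rfl

/-! ### Regular functions on `𝔾_m` on positive numbers -/

/-- Squares are positive, so `eq_of_pow_eq` with exponent `2` applies. This carries facts from the
identity component of `ℝˣ`, which the exponential reaches, to negative `t`. -/
lemma eq_of_eq_on_pos {f g : ℝˣ → ℝ} (hf : f ∈ regGm) (hg : g ∈ regGm)
    (h : ∀ t : ℝˣ, (0 : ℝ) < t → f t = g t) : f = g :=
  eq_of_pow_eq hf hg two_pos fun t => h _ (by
    rw [Units.val_pow_eq_pow_val]
    exact even_two.pow_pos t.ne_zero)

lemma zpow_mem_regGm (m : ℤ) : (fun t : ℝˣ => ((t ^ m : ℝˣ) : ℝ)) ∈ regGm :=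
  pow_mem_regGm (f := fun t : ℝˣ => (t : ℝ)) (Algebra.subset_adjoin (Or.inl rfl)) m

/-- A regular function on `𝔾_m` which is a real power of `t` for positive `t` is an integral
power of `t`. -/
lemma exists_zpow_of_mem_regGm {f : ℝˣ → ℝ} (hf : f ∈ regGm) {c : ℝ}
    (h : ∀ s : ℝ, f (unitOf (Real.exp s)) = Real.exp (s * c)) :
    ∃ m : ℤ, c = m ∧ ∀ t : ℝˣ, f t = ((t ^ m : ℝˣ) : ℝ) := by
  obtain ⟨p, k, hp⟩ := exists_of_mem_regGm hf
  have hpe : ∀ s : ℝ, p.eval (Real.exp s) = Real.exp (s * (c + k)) := fun s => by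
    have h1 := hp (unitOf (Real.exp s))
    rw [h, coe_unitOf (Real.exp_ne_zero s), ← Real.exp_nat_mul, ← Real.exp_add] at h1
    rw [← h1]; congr 1; ring
  have hp0 : p ≠ 0 := by
    rintro rfl
    have := hpe 0
    simp at this
  have hlc : p.leadingCoeff ≠ 0 := Polynomial.leadingCoeff_ne_zero.2 hp0
  -- Dividing `p (exp s) = exp (s (c + k))` by the top power of `exp s` leaves an exponential with a
  -- finite nonzero limit, which forces its exponent to vanish.
  have hlim : Tendsto (fun s : ℝ => Real.exp (s * (c + k - p.natDegree))) atTop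
      (𝓝 p.leadingCoeff) := by
    have h1 : Tendsto (fun x : ℝ => p.eval x / (Polynomial.X ^ p.natDegree : Polynomial ℝ).eval x)
        atTop (𝓝 (p.leadingCoeff / (Polynomial.X ^ p.natDegree : Polynomial ℝ).leadingCoeff)) :=
      Polynomial.div_tendsto_atTop_leadingCoeff_div_of_degree_eq _ _ (by
        rw [Polynomial.degree_X_pow, Polynomial.degree_eq_natDegree hp0])
    have h2 := h1.comp Real.tendsto_exp_atTop
    simp only [Polynomial.leadingCoeff_X_pow, div_one] at h2
    refine h2.congr fun s => ?_
    simp only [Function.comp, Polynomial.eval_pow, Polynomial.eval_X]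
    rw [hpe, ← Real.exp_nat_mul, ← Real.exp_sub]
    congr 1; ring
  have hdeg : c + k - p.natDegree = 0 := by
    rcases lt_trichotomy (c + k - p.natDegree) 0 with hneg | h0 | hpos
    · have : Tendsto (fun s : ℝ => Real.exp (s * (c + k - p.natDegree))) atTop (𝓝 0) :=
        Real.tendsto_exp_atBot.comp (tendsto_id.atTop_mul_const_of_neg hneg)
      exact absurd (tendsto_nhds_unique hlim this) hlc
    · exact h0
    · have : Tendsto (fun s : ℝ => Real.exp (s * (c + k - p.natDegree))) atTop atTop :=
        Real.tendsto_exp_atTop.comp (tendsto_id.atTop_mul_const hpos)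
      exact absurd hlim (not_tendsto_nhds_of_tendsto_atTop this _)
  refine ⟨p.natDegree - k, by push_cast; linarith, fun t => ?_⟩
  have hc : c = ((p.natDegree - k : ℤ) : ℝ) := by push_cast; linarith
  refine congrFun (eq_of_eq_on_pos hf (zpow_mem_regGm _) fun t ht => ?_) t
  have ht' : t = unitOf (Real.exp (Real.log t)) := by
    rw [Real.exp_log ht, unitOf_coe]
  rw [ht', h, hc, Units.val_zpow_eq_zpow_val, coe_unitOf (Real.exp_ne_zero _), ← Real.rpow_intCast,
    ← Real.exp_mul]

section Torus

/-! ### Regular functions along one-parameter subgroups -/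

/-- The exponential of a vector, as a point of `𝔾_m ^ d`. -/
def expTorus {d : ℕ} (x : Fin d → ℝ) : Fin d → ℝˣ := fun i => unitOf (Real.exp (x i))

lemma coe_expTorus {d : ℕ} (x : Fin d → ℝ) (i : Fin d) :
    ((expTorus x i : ℝˣ) : ℝ) = Real.exp (x i) := coe_unitOf (Real.exp_ne_zero _)

lemma expTorus_add {d : ℕ} (x y : Fin d → ℝ) : expTorus (x + y) = expTorus x * expTorus y := by
  ext i
  simp [coe_expTorus, Real.exp_add]

lemma expTorus_zero {d : ℕ} : expTorus (0 : Fin d → ℝ) = 1 := by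
  ext i
  simp [coe_expTorus]

lemma comp_expTorus_mem_expPoly {d : ℕ} {f : (Fin d → ℝˣ) → ℝ} (hf : f ∈ regTorus d)
    (x : Fin d → ℝ) : (fun s : ℝ => f (expTorus (s • x))) ∈ expPoly := by
  induction hf using Algebra.adjoin_induction with
  | mem y hy =>
    rcases hy with ⟨i, rfl⟩ | ⟨i, rfl⟩
    · simpa [coe_expTorus] using exp_mem_expPoly (x i)
    · simpa [coe_expTorus, ← Real.exp_neg] using exp_mem_expPoly (-x i)
  | algebraMap r => exact expPoly.algebraMap_mem r
  | add y z _ _ hy hz => exact add_mem hy hz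
  | mul y z _ _ hy hz => exact mul_mem hy hz

lemma comp_zpow_mem_regGm {d : ℕ} {f : (Fin d → ℝˣ) → ℝ} (hf : f ∈ regTorus d)
    (a : Fin d → ℤ) : (fun t : ℝˣ => f fun i => t ^ a i) ∈ regGm := by
  induction hf using Algebra.adjoin_induction with
  | mem y hy =>
    rcases hy with ⟨i, rfl⟩ | ⟨i, rfl⟩
    · exact zpow_mem_regGm (a i)
    · simpa only [zpow_neg] using zpow_mem_regGm (-a i)
  | algebraMap r => exact regGm.algebraMap_mem r
  | add y z _ _ hy hz => exact add_mem hy hz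
  | mul y z _ _ hy hz => exact mul_mem hy hz

variable {N : ℕ}

lemma expGL_coe (X : Matrix (Fin N) (Fin N) ℝ) :
    ((expGL X : GL (Fin N) ℝ) : Matrix (Fin N) (Fin N) ℝ) = NormedSpace.exp X := rfl

lemma expGL_zero : expGL (0 : Matrix (Fin N) (Fin N) ℝ) = 1 := by
  ext1
  simp [expGL_coe]

lemma expGL_smul_add (X : Matrix (Fin N) (Fin N) ℝ) (s t : ℝ) :
    expGL ((s + t) • X) = expGL (s • X) * expGL (t • X) := by
  ext1
  rw [Units.val_mul, expGL_coe, expGL_coe, expGL_coe, add_smul,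
    Matrix.exp_add_of_commute _ _ (((Commute.refl X).smul_left s).smul_right t)]

lemma expGL_nsmul (X : Matrix (Fin N) (Fin N) ℝ) (n : ℕ) : expGL ((n : ℝ) • X) = expGL X ^ n := by
  induction n with
  | zero => simp [expGL_zero]
  | succ n ih => rw [Nat.cast_succ, expGL_smul_add, ih, one_smul, pow_succ]

open scoped Matrix.Norms.Operator in
lemma hasDerivAt_expGL (X : Matrix (Fin N) (Fin N) ℝ) (i j : Fin N) :
    HasDerivAt (fun s : ℝ => (expGL (s • X) : Matrix (Fin N) (Fin N) ℝ) i j) (X i j) 0 := by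
  have h : HasDerivAt (fun s : ℝ => NormedSpace.exp (s • X)) (NormedSpace.exp ((0 : ℝ) • X) * X) 0 :=
    hasDerivAt_exp_smul_const X (0 : ℝ)
  rw [zero_smul, NormedSpace.exp_zero, one_mul] at h
  exact hasDerivAt_pi.1 (hasDerivAt_pi.1 h i) j

lemma expGL_smul_injective {X Y : Matrix (Fin N) (Fin N) ℝ}
    (h : ∀ s : ℝ, expGL (s • X) = expGL (s • Y)) : X = Y := by
  ext i j
  refine (hasDerivAt_expGL X i j).unique ?_
  simp only [h]
  exact hasDerivAt_expGL Y i j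

lemma differentiableAt_det {φ : ℝ → Matrix (Fin N) (Fin N) ℝ} {s : ℝ}
    (h : ∀ i j, DifferentiableAt ℝ (fun s => φ s i j) s) :
    DifferentiableAt ℝ (fun s => (φ s).det) s := by
  simp only [Matrix.det_apply]
  refine DifferentiableAt.fun_sum fun σ _ => ?_
  simp only [Units.smul_def, ← Int.cast_smul_eq_zsmul ℝ]
  refine DifferentiableAt.fun_const_smul ?_ _
  exact DifferentiableAt.fun_finsetProd fun i _ => h _ _

lemma differentiableAt_regGL {F : GL (Fin N) ℝ → ℝ} (hF : F ∈ regGL N)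
    (X : Matrix (Fin N) (Fin N) ℝ) : DifferentiableAt ℝ (fun s : ℝ => F (expGL (s • X))) 0 := by
  induction hF using Algebra.adjoin_induction with
  | mem y hy =>
    rcases hy with ⟨i, j, rfl⟩ | hy
    · exact (hasDerivAt_expGL X i j).differentiableAt
    · rw [Set.mem_singleton_iff] at hy
      subst hy
      refine (differentiableAt_det fun i j => (hasDerivAt_expGL X i j).differentiableAt).fun_inv ?_
      exact ((Matrix.isUnit_iff_isUnit_det _).1 (expGL _).isUnit).ne_zero
  | algebraMap r => exact differentiableAt_const _
  | add y z _ _ hy hz => exact hy.add hz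
  | mul y z _ _ hy hz => exact hy.mul hz

lemma det_mem {R : Type*} (S : Subalgebra ℝ (R → ℝ)) {φ : R → Matrix (Fin N) (Fin N) ℝ}
    (h : ∀ i j, (fun s => φ s i j) ∈ S) : (fun s => (φ s).det) ∈ S := by
  have : (fun s => (φ s).det) = ∑ σ : Equiv.Perm (Fin N), ((Equiv.Perm.sign σ : ℤ) : ℝ) •
        ∏ i, fun s => φ s (σ i) i := by
    ext s
    simp [Matrix.det_apply, Finset.sum_apply, Finset.prod_apply, Units.smul_def]
  rw [this]
  exact sum_mem fun σ _ => S.smul_mem (prod_mem fun i _ => h _ _) _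

/-- The generator `1 / det` causes no trouble: at `exp (s X)` it equals `det (exp (-s X))`, and
exponential polynomials are stable under `s ↦ -s`. -/
lemma comp_expGL_mem_expPoly {X : Matrix (Fin N) (Fin N) ℝ}
    (hX : ∀ i j, (fun s : ℝ => (expGL (s • X) : Matrix (Fin N) (Fin N) ℝ) i j) ∈ expPoly)
    {F : GL (Fin N) ℝ → ℝ} (hF : F ∈ regGL N) : (fun s : ℝ => F (expGL (s • X))) ∈ expPoly := by
  induction hF using Algebra.adjoin_induction with
  | mem y hy =>
    rcases hy with ⟨i, j, rfl⟩ | hy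
    · exact hX i j
    · rw [Set.mem_singleton_iff] at hy
      subst hy
      convert comp_neg_mem_expPoly (det_mem expPoly hX) using 1
      ext s
      refine inv_eq_of_mul_eq_one_right ?_
      rw [← Matrix.det_mul, ← Units.val_mul, ← expGL_smul_add, add_neg_cancel, zero_smul,
        expGL_zero, Units.val_one, Matrix.det_one]
  | algebraMap r => exact expPoly.algebraMap_mem r
  | add y z _ _ hy hz => exact add_mem hy hz
  | mul y z _ _ hy hz => exact mul_mem hy hz

/-! ### Coordinates on a split torus -/

/-- An algebraic isomorphism of `A` with `𝔾_m ^ d`. -/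
structure TorusChart (A : Subgroup (GL (Fin N) ℝ)) (d : ℕ) where
  equiv : (Fin d → ℝˣ) ≃* A
  regular : ∀ i j,
    (fun t => ((equiv t : GL (Fin N) ℝ) : Matrix (Fin N) (Fin N) ℝ) i j) ∈ regTorus d
  symm_regular : ∀ i, ∃ F ∈ regGL N, ∀ a : A, ((equiv.symm a i : ℝˣ) : ℝ) = F a

namespace TorusChart

variable {A : Subgroup (GL (Fin N) ℝ)} {d : ℕ} (e : TorusChart A d)

include e in
lemma commute (a b : A) : a * b = b * a := by
  apply e.equiv.symm.injective
  rw [map_mul, map_mul, mul_comm]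

/-- The matrix with coordinates `exp (s x)`. -/
def curve (x : Fin d → ℝ) (s : ℝ) : Matrix (Fin N) (Fin N) ℝ :=
  ((e.equiv (expTorus (s • x)) : GL (Fin N) ℝ) : Matrix (Fin N) (Fin N) ℝ)

lemma curve_mem_expPoly (x : Fin d → ℝ) (i j : Fin N) : (fun s => e.curve x s i j) ∈ expPoly :=
  comp_expTorus_mem_expPoly (e.regular i j) x

/-- The tangent vector of the curve `exp (s x)` at `s = 0`. -/
def velocityMatrix (x : Fin d → ℝ) : Matrix (Fin N) (Fin N) ℝ :=
  Matrix.of fun i j => deriv (fun s => e.curve x s i j) 0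

lemma curve_zero (x : Fin d → ℝ) : e.curve x 0 = 1 := by
  simp [curve, expTorus_zero]

lemma curve_map_add (x : Fin d → ℝ) (s t : ℝ) :
    e.curve x (s + t) = e.curve x s * e.curve x t := by
  simp [curve, add_smul, expTorus_add]

section
open scoped Matrix.Norms.Operator

lemma hasDerivAt_curve (x : Fin d → ℝ) : HasDerivAt (e.curve x) (e.velocityMatrix x) 0 :=
  hasDerivAt_pi.2 fun i => hasDerivAt_pi.2 fun j =>
    (differentiable_of_mem_expPoly (e.curve_mem_expPoly x i j)).differentiableAt.hasDerivAt

lemma curve_eq_exp (x : Fin d → ℝ) (s : ℝ) :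
    e.curve x s = NormedSpace.exp (s • e.velocityMatrix x) :=
  eq_exp_of_map_add (e.curve_zero x) (e.curve_map_add x) (e.hasDerivAt_curve x) s

lemma velocityMatrix_add (x y : Fin d → ℝ) :
    e.velocityMatrix (x + y) = e.velocityMatrix x + e.velocityMatrix y := by
  have h := (e.hasDerivAt_curve x).mul (e.hasDerivAt_curve y)
  rw [curve_zero, curve_zero, mul_one, one_mul] at h
  refine (e.hasDerivAt_curve (x + y)).unique (h.congr_of_eventuallyEq ?_)
  refine Eventually.of_forall fun s => ?_
  simp [curve, smul_add, expTorus_add]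

lemma velocityMatrix_smul (c : ℝ) (x : Fin d → ℝ) :
    e.velocityMatrix (c • x) = c • e.velocityMatrix x := by
  have h1 : HasDerivAt (fun s : ℝ => s * c) c 0 := by
    simpa using (hasDerivAt_id (0 : ℝ)).mul_const c
  have h2 : HasDerivAt (e.curve x) (e.velocityMatrix x) (0 * c) := by
    simpa using e.hasDerivAt_curve x
  refine (e.hasDerivAt_curve (c • x)).unique ((h2.scomp (0 : ℝ) h1).congr_of_eventuallyEq ?_)
  refine Eventually.of_forall fun s => ?_
  simp [curve, smul_smul]

end

/-- The parametrization of the Lie algebra of `A` by `ℝ ^ d`. -/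
def velocity : (Fin d → ℝ) →ₗ[ℝ] Matrix (Fin N) (Fin N) ℝ where
  toFun := e.velocityMatrix
  map_add' := e.velocityMatrix_add
  map_smul' := e.velocityMatrix_smul

lemma expGL_velocity (x : Fin d → ℝ) : expGL (e.velocity x) = (e.equiv (expTorus x) : GL (Fin N) ℝ) := by
  ext1
  have := e.curve_eq_exp x 1
  rw [one_smul, curve, one_smul] at this
  exact this.symm

lemma expGL_smul_velocity (x : Fin d → ℝ) (s : ℝ) :
    expGL (s • e.velocity x) = (e.equiv (expTorus (s • x)) : GL (Fin N) ℝ) := by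
  rw [← map_smul, expGL_velocity]

lemma velocity_mem (x : Fin d → ℝ) : e.velocity x ∈ lieAlg A := fun s => by
  rw [expGL_smul_velocity]
  exact (e.equiv _).2

/-- The torus coordinates of `exp (s X)` are multiplicative in `s`, and differentiable at `0`
because the inverse chart is regular. Hence they are exponentials `exp (s x_i)`, and the `x_i` are
the coordinates sought. -/
lemma exists_velocity_eq {X : Matrix (Fin N) (Fin N) ℝ} (hX : X ∈ lieAlg A) :
    ∃ x, e.velocity x = X := by
  let τ : Fin d → ℝ → ℝ := fun i s => ((e.equiv.symm ⟨expGL (s • X), hX s⟩ i : ℝˣ) : ℝ)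
  have hadd : ∀ i s t, τ i (s + t) = τ i s * τ i t := fun i s t => by
    have : (⟨expGL ((s + t) • X), hX (s + t)⟩ : A) = ⟨expGL (s • X), hX s⟩ * ⟨expGL (t • X), hX t⟩ :=
      Subtype.ext (expGL_smul_add X s t)
    simp only [τ, this, map_mul, Pi.mul_apply, Units.val_mul]
  have h0 : ∀ i, τ i 0 = 1 := fun i => by
    have h1 := hadd i 0 0
    rw [add_zero] at h1
    exact (mul_eq_left₀ (Units.ne_zero _)).1 h1.symm
  have hd : ∀ i, ∃ c, HasDerivAt (τ i) c 0 := fun i => by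
    obtain ⟨F, hF, hFe⟩ := e.symm_regular i
    refine ⟨_, DifferentiableAt.hasDerivAt ?_⟩
    simp only [τ, hFe]
    exact differentiableAt_regGL hF X
  choose x hx using hd
  have hτ : ∀ i s, τ i s = Real.exp (s * x i) := fun i s => by
    have := eq_exp_smul_of_hasDerivAt (u := τ i) (c := x i) (fun s => by
      have := hasDerivAt_of_map_add (hadd i) (hx i) s
      rwa [mul_comm] at this) s
    simpa [h0] using this
  refine ⟨x, expGL_smul_injective fun s => ?_⟩
  rw [expGL_smul_velocity]
  have : expTorus (s • x) = e.equiv.symm ⟨expGL (s • X), hX s⟩ := by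
    ext i
    rw [coe_expTorus]
    exact (hτ i s).symm
  rw [this, MulEquiv.apply_symm_apply]

/-- The cocharacter `t ↦ (t ^ a_1, …, t ^ a_d)`. -/
def cochar (a : Fin d → ℤ) : Cochar A where
  toHom := e.equiv.toMonoidHom.comp
    { toFun := fun t i => t ^ a i
      map_one' := by ext; simp
      map_mul' := fun s t => by ext; simp [mul_zpow] }
  regular i j := comp_zpow_mem_regGm (e.regular i j) a

lemma tangent_cochar (a : Fin d → ℤ) : (e.cochar a).tangent = e.velocity fun i => (a i : ℝ) := by
  refine expGL_smul_injective fun s => ?_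
  rw [expGL_smul_velocity]
  ext1
  rw [expGL_coe, ← Cochar.mat_exp, Cochar.mat]
  congr 2
  change e.equiv (fun i => unitOf (Real.exp s) ^ a i) = _
  congr 1
  ext i
  rw [coe_expTorus, Units.val_zpow_eq_zpow_val, coe_unitOf (Real.exp_ne_zero s),
    ← Real.rpow_intCast, ← Real.exp_mul]
  rfl

/-- Rational points of the Lie algebra come from rational cocharacters. -/
lemma exists_lie_eq (z : Fin d → ℚ) :
    ∃ η : M A, (M.lie η : Matrix (Fin N) (Fin N) ℝ) = e.velocity fun i => (z i : ℝ) := by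
  -- A common denominator of the coordinates.
  let n : ℕ := ∏ i, (z i).den
  have hn : 0 < n := Finset.prod_pos fun i _ => (z i).den_pos
  have ha : ∀ i, ∃ a : ℤ, (a : ℝ) = n * z i := fun i => by
    obtain ⟨k, hk⟩ := Finset.dvd_prod_of_mem (fun i => (z i).den) (Finset.mem_univ i)
    refine ⟨k * (z i).num, ?_⟩
    have h1 : ((z i).den : ℝ) * z i = (z i).num := by exact_mod_cast (z i).den_mul_eq_num
    have h2 : (n : ℝ) = (z i).den * k := by exact_mod_cast hk
    push_cast
    rw [h2, ← h1]; ring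
  choose a ha using ha
  refine ⟨M.mk (e.cochar a) ⟨n, hn⟩, ?_⟩
  change ((n : ℝ))⁻¹ • (e.cochar a).tangent = _
  rw [tangent_cochar, ← map_smul]
  congr 1
  ext i
  have : (n : ℝ) ≠ 0 := by exact_mod_cast hn.ne'
  simp [ha, this]

end TorusChart

lemma IsSplitTorus.exists_chart {A : Subgroup (GL (Fin N) ℝ)} (hA : IsSplitTorus A) :
    ∃ d, Nonempty (TorusChart A d) := by
  obtain ⟨-, d, e, h1, h2⟩ := hA
  exact ⟨d, ⟨⟨e, h1, h2⟩⟩⟩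

end Torus

/-! ### Weights of a representation of a split torus -/

section Flow

variable {N : ℕ} {G : Subgroup (GL (Fin N) ℝ)} {V : Type*}
  [NormedAddCommGroup V] [InnerProductSpace ℝ V] [FiniteDimensional ℝ V]

lemma smul_mem_lieAlg {X : Matrix (Fin N) (Fin N) ℝ} (hX : X ∈ lieAlg G) (c : ℝ) :
    c • X ∈ lieAlg G := fun s => by
  rw [smul_smul]
  exact hX _

lemma Cochar.tangent_mem (l : Cochar G) : l.tangent ∈ lieAlg G := by
  simpa using l.smul_tangent_mem 1

lemma Cochar.expGL_smul_tangent (l : Cochar G) (s : ℝ) :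
    expGL (s • l.tangent) = (l.toHom (unitOf (Real.exp s)) : GL (Fin N) ℝ) := by
  ext1
  rw [expGL_coe, ← Cochar.mat_exp, Cochar.mat]

/-- The element `exp (s X)` of `G`. -/
def lieExp (X : lieAlg G) (s : ℝ) : G := ⟨expGL (s • (X : Matrix (Fin N) (Fin N) ℝ)), X.2 s⟩

lemma lieExp_add (X : lieAlg G) (s t : ℝ) : lieExp X (s + t) = lieExp X s * lieExp X t :=
  Subtype.ext (expGL_smul_add _ s t)

lemma lieExp_zero (X : lieAlg G) : lieExp X 0 = 1 :=
  Subtype.ext (by simp [lieExp, expGL_zero])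

lemma lieExp_smul (X : lieAlg G) (c s : ℝ) :
    lieExp ⟨c • (X : Matrix (Fin N) (Fin N) ℝ), smul_mem_lieAlg X.2 c⟩ s = lieExp X (s * c) :=
  Subtype.ext (by simp [lieExp, smul_smul])

lemma lieExp_tangent (l : Cochar G) (s : ℝ) :
    lieExp ⟨l.tangent, l.tangent_mem⟩ s = l.toHom (unitOf (Real.exp s)) :=
  Subtype.ext (l.expGL_smul_tangent s)

namespace AlgRep

variable (ρ : AlgRep G V)

/-- The operator `ρ (exp (s X))`. -/
def flow (X : lieAlg G) (s : ℝ) : V →L[ℝ] V :=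
  LinearMap.toContinuousLinearMap (ρ.toRep (lieExp X s))

lemma flow_apply (X : lieAlg G) (s : ℝ) (v : V) : ρ.flow X s v = ρ.toRep (lieExp X s) v := rfl

lemma flow_add (X : lieAlg G) (s t : ℝ) : ρ.flow X (s + t) = ρ.flow X s * ρ.flow X t := by
  ext v
  simp [flow_apply, lieExp_add]

/-- The differential is defined through `deriv`, so differentiability has to be supplied. It comes
from the regularity of the matrix coefficients, after expanding the operator in a basis. -/
lemma hasDerivAt_flow (X : lieAlg G) :
    HasDerivAt (ρ.flow X) (LinearMap.toContinuousLinearMap (ρ.diff X)) 0 := by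
  have hd : DifferentiableAt ℝ (ρ.flow X) 0 := by
    let b := Module.finBasis ℝ V
    have h : ρ.flow X = fun s => ∑ i, ContinuousLinearMap.smulRightL ℝ V V
        (LinearMap.toContinuousLinearMap (b.coord i)) (∑ j, b.coord j (ρ.flow X s (b i)) • b j) := by
      ext s v
      simp only [Module.Basis.coord_apply, b.sum_repr]
      conv_lhs => rw [← b.sum_repr v, map_sum]
      simp
    rw [h]
    refine DifferentiableAt.fun_sum fun i _ => ?_
    refine (ContinuousLinearMap.differentiableAt _).comp (0 : ℝ)
      (DifferentiableAt.fun_sum fun j _ => DifferentiableAt.smul_const ?_ _)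
    obtain ⟨F, hF, hFl⟩ := ρ.regular (b i) (b.coord j)
    simp only [flow_apply, hFl]
    exact differentiableAt_regGL hF X
  have : LinearMap.toContinuousLinearMap (ρ.diff X) = deriv (ρ.flow X) 0 := by
    ext v
    rfl
  rw [this]
  exact hd.hasDerivAt

lemma hasDerivAt_flow_apply (X : lieAlg G) (v : V) :
    HasDerivAt (fun s => ρ.flow X s v) (ρ.diff X v) 0 :=
  ((ContinuousLinearMap.apply ℝ V v).hasFDerivAt.comp_hasDerivAt (0 : ℝ) (ρ.hasDerivAt_flow X) :)

/-- Differentiating `ρ(exp (sX)) ρ(g) = ρ(g) ρ(exp (sX))` shows that `π(X)` commutes with every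
`ρ(g)`; taking `g = exp (sY)` and differentiating again gives the claim. -/
lemma commute_diff (hG : ∀ a b : G, a * b = b * a) (X Y : lieAlg G) :
    Commute (ρ.diff X) (ρ.diff Y) := by
  have hXg : ∀ (g : G) (v : V), ρ.diff X (ρ.toRep g v) = ρ.toRep g (ρ.diff X v) := fun g v => by
    refine (ρ.hasDerivAt_flow_apply X (ρ.toRep g v)).unique ?_
    have h := (LinearMap.toContinuousLinearMap (ρ.toRep g)).hasFDerivAt.comp_hasDerivAt (0 : ℝ)
      (ρ.hasDerivAt_flow_apply X v)
    refine h.congr_of_eventuallyEq (Eventually.of_forall fun s => ?_)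
    simp only [flow_apply, Function.comp, LinearMap.coe_toContinuousLinearMap',
      ← Module.End.mul_apply, ← map_mul, hG g]
  refine LinearMap.ext fun v => ?_
  rw [Module.End.mul_apply, Module.End.mul_apply]
  have h1 := (LinearMap.toContinuousLinearMap (ρ.diff X)).hasFDerivAt.comp_hasDerivAt (0 : ℝ)
      (ρ.hasDerivAt_flow_apply Y v)
  refine h1.unique ((ρ.hasDerivAt_flow_apply Y (ρ.diff X v)).congr_of_eventuallyEq
    (Eventually.of_forall fun s => ?_))
  exact hXg _ _

/-- A basis of `V` consisting of common eigenvectors of the operators `π(X)`. -/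
structure WeightBasis (n : ℕ) where
  basis : Module.Basis (Fin n) ℝ V
  weight : Fin n → lieAlg G → ℝ
  diff_apply : ∀ k X, ρ.diff X (basis k) = weight k X • basis k

/-- Commuting symmetric operators are simultaneously diagonalizable: `V` is the direct sum of the
joint eigenspaces, and their bases are collected. -/
lemma exists_weightBasis (hG : ∀ a b : G, a * b = b * a) (hρ : ∀ X, (ρ.diff X).IsSymmetric) :
    ∃ n, Nonempty (ρ.WeightBasis n) := by
  classical
  let W : (lieAlg G → ℝ) → Submodule ℝ V := fun χ => ⨅ X, Module.End.eigenspace (ρ.diff X) (χ X)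
  have hW : DirectSum.IsInternal W := by
    rw [(LinearMap.IsSymmetric.orthogonalFamily_iInf_eigenspaces hρ).isInternal_iff,
      LinearMap.IsSymmetric.iSup_iInf_eq_top_of_commute hρ fun X Y _ => ρ.commute_diff hG X Y,
      Submodule.top_orthogonal_eq_bot]
  let b := hW.collectedBasis fun χ => Module.finBasis ℝ (W χ)
  have hb : ∀ a, b a ∈ W a.1 := hW.collectedBasis_mem _
  have := FiniteDimensional.fintypeBasisIndex b
  refine ⟨_, ⟨⟨b.reindex (Fintype.equivFin _), fun k => ((Fintype.equivFin _).symm k).1,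
    fun k X => ?_⟩⟩⟩
  rw [Module.Basis.reindex_apply, ← Module.End.mem_eigenspace_iff]
  exact (Submodule.mem_iInf _).1 (hb _) X

namespace WeightBasis

variable {ρ} {n : ℕ} (b : ρ.WeightBasis n)

lemma toRep_lieExp_basis (X : lieAlg G) (s : ℝ) (k : Fin n) :
    ρ.toRep (lieExp X s) (b.basis k) = Real.exp (s * b.weight k X) • b.basis k := by
  have h := eq_exp_smul_of_hasDerivAt (u := fun s => ρ.flow X s (b.basis k)) (c := b.weight k X)
    (fun s => ?_) s
  · simpa [flow_apply, lieExp_zero] using h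
  · have h1 := hasDerivAt_of_map_add (ρ.flow_add X) (ρ.hasDerivAt_flow X) s
    have h2 := (ContinuousLinearMap.apply ℝ V (b.basis k)).hasFDerivAt.comp_hasDerivAt s h1
    have h3 : (ContinuousLinearMap.apply ℝ V (b.basis k))
        (ρ.flow X s * LinearMap.toContinuousLinearMap (ρ.diff X)) =
        b.weight k X • ρ.flow X s (b.basis k) := by
      simp [b.diff_apply]
    rw [h3] at h2
    exact h2

lemma repr_of_apply_basis {T : V →ₗ[ℝ] V} {c : Fin n → ℝ}
    (h : ∀ k, T (b.basis k) = c k • b.basis k) (v : V) (k : Fin n) :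
    b.basis.repr (T v) k = c k * b.basis.repr v k := by
  conv_lhs => rw [← b.basis.sum_repr v]
  simp only [map_sum, map_smul, h, Finsupp.coe_finsetSum, Finset.sum_apply,
    Finsupp.smul_apply, Module.Basis.repr_self, smul_eq_mul]
  rw [Finset.sum_eq_single k (fun j _ hj => by simp [hj]) (by simp)]
  simp [mul_comm]

lemma repr_toRep_lieExp (X : lieAlg G) (s : ℝ) (v : V) (k : Fin n) :
    b.basis.repr (ρ.toRep (lieExp X s) v) k =
      Real.exp (s * b.weight k X) * b.basis.repr v k :=
  b.repr_of_apply_basis (b.toRep_lieExp_basis X s) v k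

/-- Weights can be read off from the group action at time `1`. Their homogeneity and additivity then
follow from the homomorphism property of `ρ`, without linearity of `diff`. -/
lemma weight_eq_of_lieExp (X : lieAlg G) (k : Fin n) {c : ℝ}
    (h : ρ.toRep (lieExp X 1) (b.basis k) = Real.exp c • b.basis k) : b.weight k X = c := by
  rw [toRep_lieExp_basis, one_mul] at h
  exact Real.exp_injective (smul_left_injective ℝ (b.basis.ne_zero k) h)

lemma weight_smul (X : lieAlg G) (c : ℝ) (k : Fin n) :
    b.weight k ⟨c • (X : Matrix (Fin N) (Fin N) ℝ), smul_mem_lieAlg X.2 c⟩ = c * b.weight k X := by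
  refine b.weight_eq_of_lieExp _ _ ?_
  rw [lieExp_smul, one_mul, toRep_lieExp_basis]

/-- For `t = exp s` the action on a weight vector is the real power of `t` given by the weight. The
diagonal coefficient is regular on `𝔾_m`, so the exponent is an integer and the formula extends to
negative `t`; the other coefficients vanish for `t > 0`, hence everywhere. -/
lemma exists_zpow (l : Cochar G) (k : Fin n) :
    ∃ m : ℤ, b.weight k ⟨l.tangent, l.tangent_mem⟩ = m ∧
      ∀ t : ℝˣ, ρ.toRep (l.toHom t) (b.basis k) = ((t ^ m : ℝˣ) : ℝ) • b.basis k := by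
  have hreg : ∀ j, (fun t => b.basis.coord j (ρ.toRep (l.toHom t) (b.basis k))) ∈ regGm := by
    intro j
    obtain ⟨F, hF, hFl⟩ := ρ.regular (b.basis k) (b.basis.coord j)
    simp only [hFl]
    exact regGL_comp hF l
  have hexp : ∀ s, ρ.toRep (l.toHom (unitOf (Real.exp s))) (b.basis k) =
      Real.exp (s * b.weight k ⟨l.tangent, l.tangent_mem⟩) • b.basis k := fun s => by
    rw [← lieExp_tangent, toRep_lieExp_basis]
  obtain ⟨m, hm, hmt⟩ := exists_zpow_of_mem_regGm (hreg k)
    (c := b.weight k ⟨l.tangent, l.tangent_mem⟩) (fun s => by rw [hexp]; simp)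
  refine ⟨m, hm, fun t => b.basis.ext_elem fun j => ?_⟩
  by_cases hj : j = k
  · subst hj
    have := hmt t
    rw [Module.Basis.coord_apply] at this
    simp [this]
  · have h0 := eq_of_eq_on_pos (hreg j) regGm.zero_mem fun t ht => by
      have ht' : t = unitOf (Real.exp (Real.log t)) := by rw [Real.exp_log ht, unitOf_coe]
      rw [ht', hexp]
      simp [Ne.symm hj]
    have := congrFun h0 t
    rw [Module.Basis.coord_apply] at this
    simp [this, Ne.symm hj]

lemma weight_lie_mk (l : Cochar G) (p : ℕ+) (k : Fin n) :
    b.weight k (M.lie (M.mk l p)) = ((p : ℕ) : ℝ)⁻¹ * b.weight k ⟨l.tangent, l.tangent_mem⟩ :=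
  b.weight_smul ⟨l.tangent, l.tangent_mem⟩ _ k

/-- The order of `λ(t) v` at `t = 0` is the smallest weight of `λ` on the support of `v`. -/
lemma exists_instabCochar (l : Cochar G) {v : V} (hv : v ≠ 0) :
    ∃ k, b.basis.repr v k ≠ 0 ∧
      (∀ j, b.basis.repr v j ≠ 0 → b.weight k ⟨l.tangent, l.tangent_mem⟩ ≤
        b.weight j ⟨l.tangent, l.tangent_mem⟩) ∧
      instabCochar ρ v l = if b.weight k ⟨l.tangent, l.tangent_mem⟩ < 0 then ⊥
        else (b.weight k ⟨l.tangent, l.tangent_mem⟩ : EReal) := by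
  choose m hm hmt using b.exists_zpow l
  have hne : (b.basis.repr v).support.Nonempty := by
    rw [Finsupp.support_nonempty_iff]
    simpa using hv
  obtain ⟨k, hk, hmin⟩ := Finset.exists_min_image _ m hne
  have hk0 : b.basis.repr v k ≠ 0 := by simpa using hk
  refine ⟨k, hk0, fun j hj => ?_, ?_⟩
  · rw [hm, hm]
    exact_mod_cast hmin j (by simpa using hj)
  · obtain ⟨r, hr, hr'⟩ := exists_order ρ hv l
    have hmr : r = m k := by
      have h2 : meromorphicOrderAt (orbitFun ρ v l) 0 = (m k : WithTop ℤ) := by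
        rw [meromorphicOrderAt_eq_int_iff (meromorphicAt_orbitFun ρ v l)]
        -- This is the orbit map divided by `t ^ m k`; its `k`-th coordinate at `0` is that of `v`,
        -- hence nonzero. Truncation by `toNat` affects only indices outside the support, where the
        -- coefficient is `0`.
        refine ⟨fun t => ∑ j, (b.basis.repr v j * t ^ (m j - m k).toNat) • b.basis j, ?_, ?_, ?_⟩
        · refine Finset.analyticAt_fun_sum _ fun j _ => ?_
          exact AnalyticAt.fun_smul (analyticAt_const.fun_mul (analyticAt_id.fun_pow _))
            analyticAt_const
        · intro h0
          have h1 := congrArg (fun w => b.basis.repr w k) h0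
          simp [Finsupp.single_apply] at h1
          exact hk0 h1
        · filter_upwards [self_mem_nhdsWithin] with t ht
          have ht : t ≠ 0 := ht
          rw [sub_zero, orbitFun, Finset.smul_sum]
          conv_lhs => rw [← b.basis.sum_repr v]
          rw [map_sum]
          refine Finset.sum_congr rfl fun j _ => ?_
          rw [map_smul, hmt, smul_smul, smul_smul, Units.val_zpow_eq_zpow_val, coe_unitOf ht]
          by_cases hj : b.basis.repr v j = 0
          · simp [hj]
          have hle := hmin j (by simpa using hj)
          congr 1
          have h3 : ((m j - m k).toNat : ℤ) = m j - m k := Int.toNat_of_nonneg (by omega)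
          rw [← zpow_natCast t, h3, mul_left_comm, ← zpow_add₀ ht]
          congr 2
          omega
      rw [hr] at h2
      exact_mod_cast h2
    rw [hr', hmr, hm]
    norm_cast

/-- The measure of instability is the smallest weight of `η` on the support of `v`. -/
lemma exists_instab (η : M G) {v : V} (hv : v ≠ 0) :
    ∃ k, b.basis.repr v k ≠ 0 ∧
      (∀ j, b.basis.repr v j ≠ 0 → b.weight k (M.lie η) ≤ b.weight j (M.lie η)) ∧
      instab ρ v η = if b.weight k (M.lie η) < 0 then ⊥ else (b.weight k (M.lie η) : EReal) := by
  obtain ⟨⟨l, p⟩, rfl⟩ := Quotient.exists_rep η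
  change ∃ k, _ ∧ (∀ j, _ → b.weight k (M.lie (M.mk l p)) ≤ b.weight j (M.lie (M.mk l p))) ∧
    ((((p : ℕ) : ℝ)⁻¹ : ℝ) : EReal) * instabCochar ρ v l = if b.weight k (M.lie (M.mk l p)) < 0
      then ⊥ else (b.weight k (M.lie (M.mk l p)) : EReal)
  have hp : (0 : ℝ) < ((p : ℕ) : ℝ)⁻¹ := by
    have : (0 : ℝ) < (p : ℕ) := by exact_mod_cast p.pos
    positivity
  obtain ⟨k, hk, hmin, h⟩ := b.exists_instabCochar l hv
  refine ⟨k, hk, fun j hj => ?_, ?_⟩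
  · rw [weight_lie_mk, weight_lie_mk]
    exact mul_le_mul_of_nonneg_left (hmin j hj) hp.le
  · rw [h, weight_lie_mk]
    by_cases hneg : b.weight k ⟨l.tangent, l.tangent_mem⟩ < 0
    · rw [if_pos hneg, if_pos (mul_neg_of_pos_of_neg hp hneg), EReal.coe_mul_bot_of_pos hp]
    · rw [if_neg hneg, if_neg (not_lt.2 (mul_nonneg hp.le (not_lt.1 hneg))), EReal.coe_mul]

/-- A minimum is at least `1` exactly when every term is. For `v = 0` the value is `⊤` and the
support is empty, so both sides hold. -/
lemma one_le_instab_iff (η : M G) (v : V) :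
    1 ≤ instab ρ v η ↔ ∀ k, b.basis.repr v k ≠ 0 → 1 ≤ b.weight k (M.lie η) := by
  by_cases hv : v = 0
  · subst hv
    obtain ⟨⟨l, p⟩, rfl⟩ := Quotient.exists_rep η
    have : instab ρ (0 : V) (Quotient.mk _ (l, p)) = ⊤ := by
      change ((((p : ℕ) : ℝ)⁻¹ : ℝ) : EReal) * instabCochar ρ 0 l = ⊤
      rw [instabCochar, if_pos rfl, EReal.coe_mul_top_of_pos]
      have : (0 : ℝ) < (p : ℕ) := by exact_mod_cast p.pos
      positivity
    simp [this]
  obtain ⟨k, hk, hmin, h⟩ := b.exists_instab η hv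
  rw [h]
  split_ifs with hneg
  · simp only [le_bot_iff]
    constructor
    · intro h1
      exact absurd h1 (EReal.coe_ne_bot 1)
    · intro h1
      linarith [h1 k hk]
  · rw [← EReal.coe_one, EReal.coe_le_coe_iff]
    exact ⟨fun h1 j hj => h1.trans (hmin j hj), fun h1 => h1 k hk⟩

end WeightBasis

end AlgRep
end Flow

/-! ### The scalar product on the Lie algebra of a split torus -/

section ScalarProduct

variable {N : ℕ}

/-- The scalar product `Tr(Xᵀ Y)` as a bilinear form. -/
def scaForm : Matrix (Fin N) (Fin N) ℝ →ₗ[ℝ] Matrix (Fin N) (Fin N) ℝ →ₗ[ℝ] ℝ :=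
  LinearMap.mk₂ ℝ sca (by simp [sca, add_mul]) (by simp [sca]) (by simp [sca, mul_add])
    (by simp [sca])

lemma scaForm_apply (X Y : Matrix (Fin N) (Fin N) ℝ) : scaForm X Y = sca X Y := rfl

lemma sca_comm (X Y : Matrix (Fin N) (Fin N) ℝ) : sca X Y = sca Y X := by
  rw [sca, ← Matrix.trace_transpose, Matrix.transpose_mul, Matrix.transpose_transpose]
  rfl

lemma sca_self_eq_sum (X : Matrix (Fin N) (Fin N) ℝ) : sca X X = ∑ j, ∑ i, X i j ^ 2 := by
  simp [sca, Matrix.trace, Matrix.mul_apply, sq]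

lemma sca_self_nonneg (X : Matrix (Fin N) (Fin N) ℝ) : 0 ≤ sca X X := by
  rw [sca_self_eq_sum]
  positivity

lemma eq_zero_of_sca_self {X : Matrix (Fin N) (Fin N) ℝ} (h : sca X X = 0) : X = 0 := by
  rw [sca_self_eq_sum, Finset.sum_eq_zero_iff_of_nonneg fun _ _ => by positivity] at h
  ext i j
  have h1 := h j (Finset.mem_univ _)
  rw [Finset.sum_eq_zero_iff_of_nonneg fun _ _ => by positivity] at h1
  simpa using h1 i (Finset.mem_univ _)

/-- The representation of `G ⊆ GL_N(ℝ)` on `ℝ ^ N`. -/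
def stdRep (G : Subgroup (GL (Fin N) ℝ)) : AlgRep G (EuclideanSpace ℝ (Fin N)) where
  toRep :=
    { toFun := fun g => Matrix.toEuclideanLin (g : GL (Fin N) ℝ).val
      map_one' := by
        ext v i
        simp
      map_mul' := fun g h => by
        ext v i
        simp [Matrix.toLpLin_apply, Matrix.mulVec_mulVec] }
  regular v l := by
    let b := (EuclideanSpace.basisFun (Fin N) ℝ).toBasis
    refine ⟨∑ i, l (b i) • ∑ j, v j • fun g : GL (Fin N) ℝ => g.val i j, ?_, fun g => ?_⟩
    · exact sum_mem fun i _ => (regGL N).smul_mem (sum_mem fun j _ =>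
        (regGL N).smul_mem (Algebra.subset_adjoin (Or.inl ⟨i, j, rfl⟩)) _) _
    · change l (Matrix.toEuclideanLin (g : GL (Fin N) ℝ).val v) = _
      conv_lhs => rw [← b.sum_repr (Matrix.toEuclideanLin (g : GL (Fin N) ℝ).val v)]
      simp only [map_sum, map_smul, Finset.sum_apply, Pi.smul_apply, smul_eq_mul]
      refine Finset.sum_congr rfl fun i _ => ?_
      rw [mul_comm]
      congr 1
      simp [b, Matrix.toLpLin_apply, Matrix.mulVec, dotProduct, mul_comm]

lemma stdRep_diff {G : Subgroup (GL (Fin N) ℝ)} (X : lieAlg G) :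
    (stdRep G).diff X = Matrix.toEuclideanLin X.val := by
  ext1 v
  ext i
  have h1 := (EuclideanSpace.proj (𝕜 := ℝ) i).hasFDerivAt.comp_hasDerivAt (0 : ℝ)
    ((stdRep G).hasDerivAt_flow_apply X v)
  refine h1.unique ?_
  have h2 : HasDerivAt (fun s : ℝ => ∑ j, (expGL (s • X.val)).val i j * v j)
      (∑ j, X.val i j * v j) 0 :=
    HasDerivAt.fun_sum fun j _ => (hasDerivAt_expGL X.val i j).mul_const _
  exact h2

variable {A : Subgroup (GL (Fin N) ℝ)}

/-- On a commutative Lie algebra of symmetric matrices, the scalar product is a sum of products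
of weights, which take integral values on cocharacters. -/
lemma exists_sca_eq_sum (hcomm : ∀ a b : A, a * b = b * a) (hsymm : ∀ X ∈ lieAlg A, Xᵀ = X) :
    ∃ (n : ℕ) (w : Fin n → lieAlg A → ℝ),
      (∀ (l : Cochar A) k, ∃ m : ℤ, w k ⟨l.tangent, l.tangent_mem⟩ = m) ∧
      ∀ X Y : lieAlg A, sca X.val Y.val = ∑ k, w k X * w k Y := by
  have hs : ∀ X, ((stdRep A).diff X).IsSymmetric := fun X => by
    rw [stdRep_diff, Matrix.isSymmetric_toEuclideanLin_iff, Matrix.IsHermitian,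
      Matrix.conjTranspose_eq_transpose_of_trivial]
    exact hsymm X.val X.2
  obtain ⟨n, ⟨b⟩⟩ := (stdRep A).exists_weightBasis hcomm hs
  refine ⟨n, b.weight, fun l k => (b.exists_zpow l k).imp fun m h => h.1, fun X Y => ?_⟩
  -- The trace of `π(X) π(Y)` is computed in two bases: the standard one gives `Tr(X Y) = Tr(Xᵀ Y)`
  -- as `X` is symmetric, the weight basis gives the sum of products of weights.
  have h1 : LinearMap.trace ℝ _ ((stdRep A).diff X * (stdRep A).diff Y) = sca X.val Y.val := by
    have h2 : (stdRep A).diff X * (stdRep A).diff Y = Matrix.toEuclideanLin (X.val * Y.val) := by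
      rw [stdRep_diff, stdRep_diff]
      ext v i
      simp [Matrix.toLpLin_apply, Matrix.mulVec_mulVec]
    rw [h2, Matrix.toEuclideanLin_eq_toLin_orthonormal,
      LinearMap.trace_eq_matrix_trace ℝ (EuclideanSpace.basisFun (Fin N) ℝ).toBasis,
      LinearMap.toMatrix_toLin, sca, hsymm X.val X.2]
  rw [← h1, LinearMap.trace_eq_matrix_trace ℝ b.basis, Matrix.trace]
  refine Finset.sum_congr rfl fun k _ => ?_
  rw [Matrix.diag_apply, LinearMap.toMatrix_apply, Module.End.mul_apply, b.diff_apply, map_smul,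
    b.diff_apply]
  simp [mul_comm]

/-- The scalar product is integral on cocharacters. -/
lemma exists_sca_tangent_eq (hcomm : ∀ a b : A, a * b = b * a) (hsymm : ∀ X ∈ lieAlg A, Xᵀ = X)
    (l l' : Cochar A) : ∃ m : ℤ, sca l.tangent l'.tangent = m := by
  obtain ⟨n, w, hw, hsca⟩ := exists_sca_eq_sum hcomm hsymm
  choose m hm using hw
  refine ⟨∑ k, m l k * m l' k, ?_⟩
  rw [hsca ⟨l.tangent, l.tangent_mem⟩ ⟨l'.tangent, l'.tangent_mem⟩]
  simp [hm]

/-- Integrality on cocharacters gives `(1/p) λ` a square norm of the form `m / p ^ 2`, so the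
default value `0` in `M.q` does not intervene. -/
lemma coe_q (hcomm : ∀ a b : A, a * b = b * a) (hsymm : ∀ X ∈ lieAlg A, Xᵀ = X) (η : M A) :
    (M.q η : ℝ) = sca (M.lie η).val (M.lie η).val := by
  have h : ∃ r : ℚ, (r : ℝ) = sca (M.lie η).val (M.lie η).val := by
    obtain ⟨⟨l, p⟩, rfl⟩ := Quotient.exists_rep η
    obtain ⟨m, hm⟩ := exists_sca_tangent_eq hcomm hsymm l l
    refine ⟨((p : ℕ) : ℚ)⁻¹ * (((p : ℕ) : ℚ)⁻¹ * m), ?_⟩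
    change _ = scaForm (((p : ℕ) : ℝ)⁻¹ • l.tangent) (((p : ℕ) : ℝ)⁻¹ • l.tangent)
    rw [map_smul, map_smul, LinearMap.smul_apply, scaForm_apply, hm]
    push_cast
    rfl
  rw [M.q, dif_pos h]
  exact h.choose_spec

/-- A cocharacter with zero tangent is trivial on positive `t` by the exponential formula, and then
everywhere by regularity. -/
lemma lie_eq_zero {η : M A} (h : (M.lie η).val = 0) : η = 0 := by
  obtain ⟨⟨l, p⟩, rfl⟩ := Quotient.exists_rep η
  have hp : ((p : ℕ) : ℝ) ≠ 0 := by exact_mod_cast p.ne_zero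
  have ht : l.tangent = 0 := by
    change ((p : ℕ) : ℝ)⁻¹ • l.tangent = 0 at h
    simpa [hp] using h
  have hpos : ∀ t : ℝˣ, (0 : ℝ) < t → l.toHom t = 1 := fun t htpos => by
    have := l.expGL_smul_tangent (Real.log t)
    rw [ht, smul_zero, expGL_zero, Real.exp_log htpos, unitOf_coe] at this
    exact Subtype.ext this.symm
  have hl : ∀ t, l.toHom t = 1 := fun t => by
    refine Subtype.ext (Units.ext (Matrix.ext fun i j => ?_))
    refine congrFun (eq_of_eq_on_pos (l.regular i j)
      (regGm.algebraMap_mem ((1 : Matrix (Fin N) (Fin N) ℝ) i j)) fun t ht => ?_) t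
    rw [hpos t ht]
    rfl
  refine Quotient.sound ?_
  change Cochar.zmul _ l = Cochar.zmul _ _
  ext1 t
  rw [Cochar.zmul_apply, Cochar.zmul_apply, hl t]
  simp

lemma lie_smul (η : M A) {r : ℚ} (hr : 0 ≤ r) :
    M.lie (r • η) = ⟨(r : ℝ) • (M.lie η).val, smul_mem_lieAlg (M.lie η).2 _⟩ := by
  obtain ⟨⟨l, p⟩, rfl⟩ := Quotient.exists_rep η
  apply Subtype.ext
  change (((r.pnatDen * p : ℕ+) : ℕ) : ℝ)⁻¹ • (Cochar.zmul r.num l).tangent =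
    (r : ℝ) • ((p : ℕ) : ℝ)⁻¹ • l.tangent
  obtain ⟨k, hk⟩ := Int.eq_ofNat_of_zero_le (Rat.num_nonneg.2 hr)
  have hrk : (r : ℝ) = k / r.den := by
    rw [Rat.cast_def, hk]
    simp
  rw [hk, Cochar.tangent_zmul, hrk, smul_smul, smul_smul]
  congr 1
  simp
  ring

/-! ### Characters and algebraic subgroups of the torus -/

namespace TorusChart

variable {d : ℕ} (e : TorusChart A d)

/-- An element of the Lie algebra of `A`, in coordinates. -/
def toLie (x : Fin d → ℝ) : lieAlg A := ⟨e.velocity x, e.velocity_mem x⟩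

lemma lieExp_toLie (x : Fin d → ℝ) : lieExp (e.toLie x) 1 = e.equiv (expTorus x) :=
  Subtype.ext ((congrArg expGL (one_smul ℝ (e.velocity x))).trans (e.expGL_velocity x))

/-- The algebraic character `∏ t_i ^ c_i` of `A`. -/
def character (c : Fin d → ℤ) : A →* ℝˣ where
  toFun a := ∏ i, e.equiv.symm a i ^ c i
  map_one' := by simp
  map_mul' a b := by simp [mul_zpow, Finset.prod_mul_distrib]

/-- Moving the negative exponents to the other side turns `∏ t_i ^ c_i = 1` into an equation between
monomials in the regular functions extending the coordinates. -/
lemma isAlgebraicSubgroup_ker (hA : IsAlgebraicSubgroup A) (c : Fin d → ℤ) :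
    IsAlgebraicSubgroup ((e.character c).ker.map A.subtype) := by
  obtain ⟨S, hS, hSA⟩ := hA
  choose F hF hFe using e.symm_regular
  refine ⟨insert (∏ i, F i ^ (c i).toNat - ∏ i, F i ^ (-c i).toNat) S,
    Set.insert_subset (sub_mem (prod_mem fun i _ => pow_mem (hF i) _)
      (prod_mem fun i _ => pow_mem (hF i) _)) hS, fun g => ?_⟩
  have key : ∀ a : A, (∏ i, F i ^ (c i).toNat - ∏ i, F i ^ (-c i).toNat) (a : GL (Fin N) ℝ) = 0 ↔
      e.character c a = 1 := by
    intro a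
    have h1 : e.character c a = (∏ i, e.equiv.symm a i ^ (c i).toNat) /
        ∏ i, e.equiv.symm a i ^ (-c i).toNat := by
      change ∏ i, e.equiv.symm a i ^ c i = _
      rw [← Finset.prod_div_distrib]
      refine Finset.prod_congr rfl fun i _ => ?_
      rw [← zpow_natCast, ← zpow_natCast, div_eq_mul_inv, ← zpow_sub]
      congr 1
      omega
    rw [h1, div_eq_one, Pi.sub_apply, sub_eq_zero, Finset.prod_apply, Finset.prod_apply,
      Units.ext_iff]
    simp [hFe]
  rw [Set.forall_mem_insert, ← hSA, Subgroup.mem_map]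
  constructor
  · rintro ⟨a, ha, rfl⟩
    exact ⟨(key a).2 ha, a.2⟩
  · rintro ⟨h1, h2⟩
    exact ⟨⟨g, h2⟩, (key ⟨g, h2⟩).1 h1, rfl⟩

lemma mem_lieAlg_ker (c : Fin d → ℤ) (x : Fin d → ℝ) :
    e.velocity x ∈ lieAlg ((e.character c).ker.map A.subtype) ↔ ∑ i, x i * c i = 0 := by
  have h : ∀ s : ℝ, expGL (s • e.velocity x) ∈ (e.character c).ker.map A.subtype ↔
      Real.exp (s * ∑ i, x i * c i) = 1 := by
    intro s
    rw [expGL_smul_velocity]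
    change A.subtype (e.equiv (expTorus (s • x))) ∈ _ ↔ _
    rw [Subgroup.mem_map_iff_mem A.subtype_injective, MonoidHom.mem_ker]
    change ∏ i, e.equiv.symm (e.equiv (expTorus (s • x))) i ^ c i = 1 ↔ _
    rw [Units.ext_iff, Units.coe_prod, Finset.mul_sum, Real.exp_sum, Units.val_one]
    simp only [MulEquiv.symm_apply_apply, Units.val_zpow_eq_zpow_val, coe_expTorus,
      ← Real.rpow_intCast, ← Real.exp_mul, Pi.smul_apply, smul_eq_mul, mul_assoc]
  constructor
  · intro hx
    simpa using (h 1).1 (hx 1)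
  · intro hx s
    rw [h, hx, mul_zero, Real.exp_zero]

lemma lieAlg_mono {H G : Subgroup (GL (Fin N) ℝ)} (h : H ≤ G) : lieAlg H ⊆ lieAlg G :=
  fun _ hX s => h (hX s)

include e in
/-- The subspace orthogonal to a rational cocharacter is the Lie algebra of an algebraic group. -/
lemma exists_isHBeta (hA : IsAlgebraicSubgroup A) (hsymm : ∀ X ∈ lieAlg A, Xᵀ = X) (η : M A) :
    ∃ H, IsHBeta A (M.lie η) H := by
  obtain ⟨⟨l, p⟩, rfl⟩ := Quotient.exists_rep η
  have hp : ((p : ℕ) : ℝ) ≠ 0 := by exact_mod_cast p.ne_zero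
  -- The integers `c i` are the scalar products of `λ` with the coordinate cocharacters, so `⟨β, ·⟩`
  -- is `1 / p` times the differential of the character with exponents `c`.
  choose c hc using fun i => exists_sca_tangent_eq e.commute hsymm l (e.cochar (Pi.single i 1))
  have hsca : ∀ x, sca (M.lie (M.mk l p)).val (e.velocity x) =
      ((p : ℕ) : ℝ)⁻¹ * ∑ i, x i * c i := by
    intro x
    change scaForm (((p : ℕ) : ℝ)⁻¹ • l.tangent) (e.velocity x) = _
    rw [map_smul, LinearMap.smul_apply, smul_eq_mul]
    congr 1
    conv_lhs => rw [pi_eq_sum_univ' x]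
    rw [map_sum, map_sum]
    refine Finset.sum_congr rfl fun i _ => ?_
    have h1 : (fun j => (((Pi.single i 1 : Fin d → ℤ) j : ℤ) : ℝ)) = Pi.single i 1 := by
      ext j
      simp [Pi.single_apply]
    rw [map_smul, map_smul, smul_eq_mul, ← hc, tangent_cochar, h1]
    rfl
  refine ⟨(e.character c).ker.map A.subtype, Subgroup.map_subtype_le _,
    e.isAlgebraicSubgroup_ker hA c, ?_⟩
  ext X
  constructor
  · intro hX
    have hXA := lieAlg_mono (Subgroup.map_subtype_le _) hX
    obtain ⟨x, rfl⟩ := e.exists_velocity_eq hXA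
    refine ⟨hXA, ?_⟩
    exact (hsca x).trans (by rw [(e.mem_lieAlg_ker c x).1 hX, mul_zero])
  · rintro ⟨hXA, hX⟩
    obtain ⟨x, rfl⟩ := e.exists_velocity_eq hXA
    rw [mem_lieAlg_ker]
    have := (hsca x).symm.trans hX
    simpa [hp] using this

/-- If an algebraic subgroup of `A` contains `exp Z`, then it contains `exp (s Z)` for all `s`. -/
lemma mem_lieAlg_of_expGL_mem {H : Subgroup (GL (Fin N) ℝ)} (hH : IsAlgebraicSubgroup H)
    {z : Fin d → ℝ} (hz : expGL (e.velocity z) ∈ H) : e.velocity z ∈ lieAlg H := by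
  obtain ⟨S, hS, hSH⟩ := hH
  intro s
  rw [hSH]
  intro F hF
  -- Along the one-parameter group each defining equation is an exponential polynomial. It vanishes
  -- at all natural `s`, because powers of `exp Z` lie in `H`, and hence identically.
  have hF' : (fun s : ℝ => F (expGL (s • e.velocity z))) ∈ expPoly := by
    refine comp_expGL_mem_expPoly (fun i j => ?_) (hS hF)
    simp only [expGL_smul_velocity]
    exact e.curve_mem_expPoly z i j
  refine congrFun (eq_zero_of_mem_expPoly hF' fun n => ?_) s
  rw [expGL_nsmul]
  exact (hSH _).1 (pow_mem hz n) F hF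

end TorusChart

end ScalarProduct

/-! ### Minimizing a quadratic form on a polyhedron -/

section Polyhedron

/-- The direction is the component of `y` orthogonal to `b`. By Cauchy-Schwarz the norm bound on `y`
gives `B b y < 1`, and an active form takes a value at least `1 - B b y` on that component. -/
lemma exists_direction_of_lt {E ι : Type*} [AddCommGroup E] [Module ℝ E]
    (B : E →ₗ[ℝ] E →ₗ[ℝ] ℝ) (hsymm : ∀ x y, B x y = B y x) (hpos : ∀ x, 0 ≤ B x x)
    {α : ι → E →ₗ[ℝ] ℝ} {S : Set ι} {b y : E} (hb : 0 < B b b)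
    (hy : ∀ k ∈ S, 1 ≤ α k y) (hlt : B y y < (B b b)⁻¹) :
    ∃ x, B b x = 0 ∧ ∀ k ∈ S, α k b = B b b → 0 < α k x := by
  have hcs : B b y < 1 := by
    have h1 := hpos (y - (B b y / B b b) • b)
    simp only [map_sub, map_smul, LinearMap.sub_apply, LinearMap.smul_apply, smul_eq_mul,
      hsymm y b] at h1
    have h2 : B b y ^ 2 / B b b ≤ B y y := by
      field_simp at h1 ⊢
      nlinarith
    have h3 : B b y ^ 2 < 1 := by
      have h4 := h2.trans_lt hlt
      rw [div_lt_iff₀ hb, inv_mul_cancel₀ hb.ne'] at h4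
      exact h4
    nlinarith
  refine ⟨y - (B b y / B b b) • b, ?_, fun k hk hkb => ?_⟩
  · rw [map_sub, map_smul, smul_eq_mul, div_mul_cancel₀ _ hb.ne', sub_self]
  · rw [map_sub, map_smul, smul_eq_mul, hkb, div_mul_cancel₀ _ hb.ne']
    linarith [hy k hk]

/-- Shrink `b / B b b` slightly and move along `x` to compensate. The norm decreases to first order
while the orthogonal move costs only second order, and inactive constraints have slack. -/
lemma exists_rat_lt_of_direction {d n : ℕ} (B : (Fin d → ℝ) →ₗ[ℝ] (Fin d → ℝ) →ₗ[ℝ] ℝ)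
    (hsymm : ∀ x y, B x y = B y x) {α : Fin n → (Fin d → ℝ) →ₗ[ℝ] ℝ} {S : Set (Fin n)}
    {b x : Fin d → ℝ} (hb : 0 < B b b) (hS : ∀ k ∈ S, B b b ≤ α k b) (hx : B b x = 0)
    (hact : ∀ k ∈ S, α k b = B b b → 0 < α k x) :
    ∃ z : Fin d → ℚ, (∀ k ∈ S, 1 ≤ α k fun i => (z i : ℝ)) ∧
      B (fun i => (z i : ℝ)) (fun i => (z i : ℝ)) < (B b b)⁻¹ := by
  set Q := B b b with hQ
  obtain ⟨K, hK⟩ : ∃ K : ℝ, ∀ k, k ∈ S → α k b = Q → 1 < K * α k x := by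
    have : ∀ᶠ K : ℝ in atTop, ∀ k, k ∈ S → α k b = Q → 1 < K * α k x := by
      rw [eventually_all]
      intro k
      by_cases h : k ∈ S ∧ α k b = Q
      · filter_upwards [(tendsto_id.atTop_mul_const (hact k h.1 h.2)).eventually_gt_atTop 1]
          with K hK _ _
        exact hK
      · exact Eventually.of_forall fun K h1 h2 => absurd ⟨h1, h2⟩ h
    exact this.exists
  -- On an active form the value is `1 - ε + ε K α_k(x)`, which exceeds `1` by the choice of `K`.
  let y : ℝ → Fin d → ℝ := fun ε => ((1 - ε) * Q⁻¹) • b + (ε * K) • x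
  have hαy : ∀ k ε, α k (y ε) = (1 - ε) * Q⁻¹ * α k b + ε * K * α k x := fun k ε => by
    simp [y]
  have h1 : ∀ᶠ ε in 𝓝[>] (0 : ℝ), ∀ k, k ∈ S → 1 < α k (y ε) := by
    rw [eventually_all]
    intro k
    by_cases hk : k ∈ S
    · rcases (hS k hk).eq_or_lt with heq | hlt
      · filter_upwards [self_mem_nhdsWithin] with ε hε _
        have hε : 0 < ε := hε
        rw [hαy, ← heq, mul_assoc, inv_mul_cancel₀ hb.ne', mul_one, mul_assoc]
        nlinarith [mul_pos hε (sub_pos.2 (hK k hk heq.symm))]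
      · have hc : Continuous fun ε => α k (y ε) := by
          simp only [hαy]
          fun_prop
        have h0 : 1 < α k (y 0) := by
          rw [hαy, sub_zero, one_mul, zero_mul, zero_mul, add_zero, inv_mul_eq_div,
            one_lt_div hb]
          exact hlt
        filter_upwards [nhdsWithin_le_nhds (hc.continuousAt.eventually (lt_mem_nhds h0))]
          with ε hε _
        exact hε
    · exact Eventually.of_forall fun ε h => absurd h hk
  have h2 : ∀ᶠ ε in 𝓝[>] (0 : ℝ), B (y ε) (y ε) < Q⁻¹ := by
    have hc : Continuous fun ε : ℝ => (2 - ε) * Q⁻¹ - ε * K ^ 2 * B x x := by fun_prop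
    have h0 : 0 < (2 - (0 : ℝ)) * Q⁻¹ - 0 * K ^ 2 * B x x := by
      have : 0 < Q⁻¹ := inv_pos.2 hb
      simpa using this
    filter_upwards [nhdsWithin_le_nhds (hc.continuousAt.eventually (lt_mem_nhds h0)),
      self_mem_nhdsWithin] with ε hε hε0
    have hε0 : 0 < ε := hε0
    have hB : B (y ε) (y ε) = Q⁻¹ - ε * ((2 - ε) * Q⁻¹ - ε * K ^ 2 * B x x) := by
      simp only [y, map_add, map_smul, LinearMap.add_apply, LinearMap.smul_apply, smul_eq_mul,
        hx, hsymm x b, ← hQ]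
      field_simp
      ring
    rw [hB]
    linarith [mul_pos hε0 hε]
  obtain ⟨ε, hε1, hε2⟩ := (h1.and h2).exists
  -- All inequalities were made strict, so density of the rational points applies.
  have hopen : IsOpen {z | (∀ k, k ∈ S → 1 < α k z) ∧ B z z < Q⁻¹} := by
    have hα : IsOpen {z | ∀ k, k ∈ S → 1 < α k z} := by
      simp only [Set.ofPred_forall]
      exact isOpen_iInter_of_finite fun k => isOpen_iInter_of_finite fun _ =>
        isOpen_lt continuous_const (α k).continuous_of_finiteDimensional
    exact hα.inter (isOpen_lt
      (B.toContinuousBilinearMap.continuous.clm_apply continuous_id) continuous_const)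
  obtain ⟨z, hz1, hz2⟩ := (DenseRange.piMap fun _ : Fin d => Rat.denseRange_cast (𝕜 := ℝ)).exists_mem_open
    hopen ⟨y ε, hε1, hε2⟩
  exact ⟨z, fun k hk => (hz1 k hk).le, hz2⟩

end Polyhedron

/-! ### Optimality and semistability in weight coordinates -/

section Instability

variable {N : ℕ} {A : Subgroup (GL (Fin N) ℝ)} {V : Type*}
  [NormedAddCommGroup V] [InnerProductSpace ℝ V] [FiniteDimensional ℝ V]

lemma mem_optimalClass_iff (ρ : AlgRep A V) (v : V) (η : M A) :
    η ∈ optimalClass ρ v ↔ 1 ≤ instab ρ v η ∧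
      ∀ ξ : M A, 1 ≤ instab ρ v ξ → (M.q η : ℝ) ≤ (M.q ξ : ℝ) := by
  refine and_congr_right fun h => ?_
  have hle : qStar ρ v ≤ ((M.q η : ℝ) : EReal) := iInf₂_le η h
  rw [← hle.ge_iff_eq', qStar, le_iInf₂_iff]
  simp only [EReal.coe_le_coe_iff]

namespace AlgRep.WeightBasis

variable {ρ : AlgRep A V} {n d : ℕ} (b : ρ.WeightBasis n) (e : TorusChart A d)

/-- A weight as a linear form in the coordinates of the Lie algebra. -/
def weightForm (k : Fin n) : (Fin d → ℝ) →ₗ[ℝ] ℝ where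
  toFun x := b.weight k (e.toLie x)
  map_add' x y := by
    refine b.weight_eq_of_lieExp _ _ ?_
    have : lieExp (e.toLie (x + y)) 1 = lieExp (e.toLie x) 1 * lieExp (e.toLie y) 1 := by
      simp only [e.lieExp_toLie, expTorus_add, map_mul]
    rw [this, map_mul, Module.End.mul_apply, toRep_lieExp_basis, map_smul, toRep_lieExp_basis,
      smul_smul, one_mul, one_mul, Real.exp_add, mul_comm]
  map_smul' c x := by
    rw [RingHom.id_apply, smul_eq_mul, ← weight_smul]
    congr 2
    exact Subtype.ext (map_smul e.velocity c x)

lemma weightForm_apply (k : Fin n) (x : Fin d → ℝ) :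
    b.weightForm e k x = b.weight k (e.toLie x) := rfl

lemma piPlus_basis (β : lieAlg A) (k : Fin n) :
    piPlus ρ β (b.basis k) = (b.weight k β - sca β.val β.val) • b.basis k := by
  rw [piPlus, LinearMap.sub_apply, b.diff_apply, sub_smul]
  rfl

lemma mem_eigV_iff (β : lieAlg A) (r : ℝ) (v : V) :
    v ∈ eigV ρ β r ↔ ∀ k, b.basis.repr v k ≠ 0 → b.weight k β = r + sca β.val β.val := by
  rw [eigV, Module.End.mem_eigenspace_iff, ← b.basis.repr.injective.eq_iff, Finsupp.ext_iff]
  refine forall_congr' fun k => ?_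
  rw [b.repr_of_apply_basis (b.piPlus_basis β), map_smul, Finsupp.smul_apply, smul_eq_mul,
    mul_eq_mul_right_iff, sub_eq_iff_eq_add, or_comm, or_iff_not_imp_left]

lemma basis_mem_eigV (β : lieAlg A) (k : Fin n) :
    b.basis k ∈ eigV ρ β (b.weight k β - sca β.val β.val) :=
  Module.End.mem_eigenspace_iff.2 (b.piPlus_basis β k)

lemma mem_nonnegV_iff (β : lieAlg A) (v : V) :
    v ∈ nonnegV ρ β ↔ ∀ k, b.basis.repr v k ≠ 0 → sca β.val β.val ≤ b.weight k β := by
  constructor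
  -- The vectors without components of weight below `‖β‖²`; this subspace contains every eigenspace
  -- with `r ≥ 0`.
  · let K : Submodule ℝ V := ⨅ (k) (_ : b.weight k β < sca β.val β.val), (b.basis.coord k).ker
    have hK : nonnegV ρ β ≤ K := by
      refine iSup₂_le fun r hr u hu => ?_
      simp only [K, Submodule.mem_iInf, LinearMap.mem_ker, Module.Basis.coord_apply]
      intro k hk
      by_contra h
      linarith [(b.mem_eigV_iff β r u).1 hu k h]
    intro hv k hk
    have h := hK hv
    simp only [K, Submodule.mem_iInf, LinearMap.mem_ker, Module.Basis.coord_apply] at h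
    by_contra hlt
    exact hk (h k (not_le.1 hlt))
  · intro h
    rw [← b.basis.sum_repr v]
    refine sum_mem fun k _ => ?_
    by_cases hk : b.basis.repr v k = 0
    · rw [hk, zero_smul]
      exact zero_mem _
    · exact Submodule.smul_mem _ _ (Submodule.mem_iSup_of_mem _
        (Submodule.mem_iSup_of_mem (sub_nonneg.2 (h k hk)) (b.basis_mem_eigV β k)))

/-- The weight basis need not be orthonormal, but eigenspaces of a symmetric operator are mutually
orthogonal. So the projection fixes the basis vectors of eigenvalue `0` and kills the others. -/
lemma repr_starProjection (hρ : ∀ X, (ρ.diff X).IsSymmetric) (β : lieAlg A) (v : V) (k : Fin n) :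
    b.basis.repr ((eigV ρ β 0).starProjection v) k =
      if b.weight k β = sca β.val β.val then b.basis.repr v k else 0 := by
  have hsymm : (piPlus ρ β).IsSymmetric :=
    (hρ β).sub (LinearMap.IsSymmetric.id.smul (by simp))
  have h : ∀ k, ((eigV ρ β 0).starProjection : V →ₗ[ℝ] V) (b.basis k) =
      (if b.weight k β = sca β.val β.val then (1 : ℝ) else 0) • b.basis k := by
    intro k
    have hk := b.basis_mem_eigV β k
    split_ifs with hw
    · rw [hw, sub_self] at hk
      rw [one_smul]
      exact Submodule.starProjection_eq_self_iff.2 hk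
    · rw [zero_smul]
      refine (Submodule.starProjection_apply_eq_zero_iff _).2 fun u hu => ?_
      exact hsymm.orthogonalFamily_eigenspaces.pairwise (sub_ne_zero.2 hw) hk _ hu
  have := b.repr_of_apply_basis h v k
  rw [ite_mul, one_mul, zero_mul] at this
  exact this

lemma exists_sign_exp (u : ℝˣ) :
    ∃ (ε : ℤˣ) (x : ℝ), u = Units.map (Int.castRingHom ℝ : ℤ →* ℝ) ε * unitOf (Real.exp x) := by
  rcases lt_or_gt_of_ne u.ne_zero with h | h
  · refine ⟨-1, Real.log (-u), ?_⟩
    ext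
    rw [Units.val_mul, coe_unitOf (Real.exp_ne_zero _), Real.exp_log (neg_pos.2 h)]
    simp
  · refine ⟨1, Real.log u, ?_⟩
    ext
    simp [coe_unitOf, Real.exp_log h]

/-- The Hilbert-Mumford criterion for the subgroup `H` of the torus `A`. -/
lemma zero_mem_closure_iff {β : lieAlg A} {H : Subgroup (GL (Fin N) ℝ)} (hH : IsHBeta A β H)
    (w : V) :
    (0 : V) ∈ closure {u | ∃ h : A, (h : GL (Fin N) ℝ) ∈ H ∧ u = ρ.toRep h w} ↔
      ∃ x, sca β.val (e.velocity x) = 0 ∧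
        ∀ k, b.basis.repr w k ≠ 0 → 0 < b.weightForm e k x := by
  obtain ⟨-, hHalg, hHlie⟩ := hH
  have hlie : ∀ x, e.velocity x ∈ lieAlg H ↔ sca β.val (e.velocity x) = 0 := fun x => by
    rw [hHlie]
    exact and_iff_right (e.velocity_mem x)
  constructor
  · intro h0
    let sg : (Fin d → ℤˣ) → Fin d → ℝˣ :=
      fun ε i => Units.map (Int.castRingHom ℝ : ℤ →* ℝ) (ε i)
    have hsg : ∀ ε, sg ε * sg ε = 1 := fun ε => by
      ext i
      have := Int.units_mul_self (ε i)
      simp only [sg, Pi.mul_apply, ← map_mul, this, map_one, Pi.one_apply]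
    -- A neighbourhood of `0`, tested against the finitely many sign elements of the torus, so that
    -- the sign part of an orbit element can be removed.
    let O : Set V := {u | ∀ ε k, b.basis.repr w k ≠ 0 →
      |b.basis.repr (ρ.toRep (e.equiv (sg ε)) u) k| < |b.basis.repr w k|}
    have hO : IsOpen O := by
      simp only [O, Set.ofPred_forall]
      refine isOpen_iInter_of_finite fun ε => isOpen_iInter_of_finite fun k =>
        isOpen_iInter_of_finite fun _ => isOpen_lt (Continuous.abs ?_) continuous_const
      exact ((b.basis.coord k) ∘ₗ ρ.toRep (e.equiv (sg ε))).continuous_of_finiteDimensional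
    obtain ⟨u, hu, h, hhH, rfl⟩ := mem_closure_iff.1 h0 O hO fun ε k hk => by simpa using hk
    choose ε x hx using fun i => exists_sign_exp (e.equiv.symm h i)
    have hh : h = e.equiv (sg ε) * e.equiv (expTorus x) := by
      rw [← map_mul, ← MulEquiv.symm_apply_eq]
      exact funext hx
    -- The positive part of `h` need not obviously lie in `H`, but squaring removes the signs and
    -- stays in `H`. Algebraicity then puts the whole one-parameter group in `H`.
    have h2 : h * h = e.equiv (expTorus ((2 : ℝ) • x)) := by
      rw [hh, ← map_mul, ← map_mul, mul_mul_mul_comm, hsg, one_mul, ← expTorus_add, two_smul]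
    have hxH : e.velocity x ∈ lieAlg H := by
      have h3 : e.velocity ((2 : ℝ) • x) ∈ lieAlg H := by
        refine e.mem_lieAlg_of_expGL_mem hHalg ?_
        rw [e.expGL_velocity, ← h2]
        exact H.mul_mem hhH hhH
      have h4 := smul_mem_lieAlg h3 (2⁻¹ : ℝ)
      rwa [← map_smul, smul_smul, inv_mul_cancel₀ two_ne_zero, one_smul] at h4
    -- `exp x` strictly shrinks each nonzero coordinate of `w`, so the weights are negative at `x`.
    refine ⟨-x, ?_, fun k hk => ?_⟩
    · rw [map_neg, ← scaForm_apply, map_neg, scaForm_apply, (hlie x).1 hxH, neg_zero]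
    · have h3 := hu ε k hk
      have h4 : e.equiv (sg ε) * h = lieExp (e.toLie x) 1 := by
        rw [hh, ← map_mul, ← map_mul, ← mul_assoc, hsg, one_mul, e.lieExp_toLie]
      rw [← Module.End.mul_apply, ← map_mul, h4, repr_toRep_lieExp, abs_mul, Real.abs_exp,
        one_mul] at h3
      have h5 := lt_of_mul_lt_mul_right (h3.trans_eq (one_mul _).symm) (abs_nonneg _)
      rw [Real.exp_lt_one_iff] at h5
      rw [map_neg, weightForm_apply]
      linarith
  · rintro ⟨x, hx, hpos⟩
    have ht : Tendsto (fun s => ρ.toRep (lieExp (e.toLie x) s) w) atBot (𝓝 0) := by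
      have h1 : (fun s => ρ.toRep (lieExp (e.toLie x) s) w) = fun s => ∑ k,
          (Real.exp (s * b.weightForm e k x) * b.basis.repr w k) • b.basis k := by
        ext s
        conv_lhs => rw [← b.basis.sum_repr (ρ.toRep (lieExp (e.toLie x) s) w)]
        simp only [repr_toRep_lieExp, weightForm_apply]
      rw [h1, ← Finset.sum_const_zero (s := (Finset.univ : Finset (Fin n)))]
      refine tendsto_finsetSum _ fun k _ => ?_
      by_cases hk : b.basis.repr w k = 0
      · simp [hk]
      · have h2 := Real.tendsto_exp_atBot.comp (tendsto_id.atBot_mul_const (hpos k hk))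
        have h3 := (h2.mul_const (b.basis.repr w k)).smul_const (b.basis k)
        rw [zero_mul, zero_smul] at h3
        exact h3
    exact mem_closure_of_tendsto ht (Eventually.of_forall fun s =>
      ⟨lieExp (e.toLie x) s, (hlie x).2 hx s, rfl⟩)

end AlgRep.WeightBasis

end Instability

/-! ### The rescaled cocharacter and its optimality -/

section Main

variable {N : ℕ} {A : Subgroup (GL (Fin N) ℝ)} {V : Type*}
  [NormedAddCommGroup V] [InnerProductSpace ℝ V] [FiniteDimensional ℝ V]
  {ρ : AlgRep A V} {n d : ℕ}

lemma coe_q_pos (hcomm : ∀ a b : A, a * b = b * a) (hsymm : ∀ X ∈ lieAlg A, Xᵀ = X) {η : M A}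
    (hη : η ≠ 0) : (0 : ℝ) < M.q η := by
  rw [coe_q hcomm hsymm]
  exact (sca_self_nonneg _).lt_of_ne' fun h => hη (lie_eq_zero (eq_zero_of_sca_self h))

lemma coe_q_inv_smul (hcomm : ∀ a b : A, a * b = b * a) (hsymm : ∀ X ∈ lieAlg A, Xᵀ = X) {η : M A}
    (hη : η ≠ 0) : (M.q ((M.q η)⁻¹ • η) : ℝ) = (M.q η : ℝ)⁻¹ := by
  have hpos := coe_q_pos hcomm hsymm hη
  have h0 : (0 : ℚ) ≤ (M.q η)⁻¹ := inv_nonneg.2 (by exact_mod_cast hpos.le)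
  rw [coe_q hcomm hsymm, lie_smul η h0]
  rw [← scaForm_apply, map_smul, map_smul, LinearMap.smul_apply, scaForm_apply,
    ← coe_q hcomm hsymm, Rat.cast_inv, smul_eq_mul, smul_eq_mul, inv_mul_cancel₀ hpos.ne', mul_one]

namespace AlgRep.WeightBasis

variable (b : ρ.WeightBasis n)

lemma weight_lie_inv_smul {η : M A} (hpos : (0 : ℝ) < M.q η) (k : Fin n) :
    b.weight k (M.lie ((M.q η)⁻¹ • η)) = (M.q η : ℝ)⁻¹ * b.weight k (M.lie η) := by
  have h0 : (0 : ℚ) ≤ (M.q η)⁻¹ := inv_nonneg.2 (by exact_mod_cast hpos.le)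
  rw [lie_smul η h0, weight_smul, Rat.cast_inv]

lemma one_le_instab_inv_smul_iff {η : M A} (hpos : (0 : ℝ) < M.q η) (v : V) :
    1 ≤ instab ρ v ((M.q η)⁻¹ • η) ↔
      ∀ k, b.basis.repr v k ≠ 0 → (M.q η : ℝ) ≤ b.weight k (M.lie η) := by
  rw [b.one_le_instab_iff]
  refine forall₂_congr fun k _ => ?_
  rw [b.weight_lie_inv_smul hpos, inv_mul_eq_div, one_le_div hpos]

include b in
-- All weights in the support of an eigenvector equal `r + q(η)`, and rescaling divides them by
-- `q(η)`.
lemma instab_of_mem_eigV (hcomm : ∀ a b : A, a * b = b * a) (hsymm : ∀ X ∈ lieAlg A, Xᵀ = X)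
    {η : M A} (hη : η ≠ 0) {r : ℝ} {v : V} (hv : v ∈ eigV ρ (M.lie η) r) (hv0 : v ≠ 0) :
    instab ρ v ((M.q η)⁻¹ • η) =
      if 1 + r / (M.q η : ℝ) < 0 then ⊥ else ((1 + r / (M.q η : ℝ) : ℝ) : EReal) := by
  have hpos := coe_q_pos hcomm hsymm hη
  obtain ⟨k, hk, -, h⟩ := b.exists_instab ((M.q η)⁻¹ • η) hv0
  have hw : b.weight k (M.lie ((M.q η)⁻¹ • η)) = 1 + r / (M.q η : ℝ) := by
    rw [b.weight_lie_inv_smul hpos, (b.mem_eigV_iff _ r v).1 hv k hk, ← coe_q hcomm hsymm]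
    field_simp
    ring
  rw [h, hw]

include b in
lemma nonnegU_eq (e : TorusChart A d) (hsymm : ∀ X ∈ lieAlg A, Xᵀ = X)
    (hρ : ∀ X : lieAlg A, (ρ.diff X).IsSymmetric) {η : M A} (hη : η ≠ 0)
    {H : Subgroup (GL (Fin N) ℝ)} (hH : IsHBeta A (M.lie η) H) :
    nonnegU ρ (M.lie η) H = {v | (M.q η)⁻¹ • η ∈ optimalClass ρ v} := by
  have hpos := coe_q_pos e.commute hsymm hη
  have hq := coe_q e.commute hsymm η
  have hlie : ∀ ξ : M A, ∃ x, e.toLie x = M.lie ξ := fun ξ =>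
    (e.exists_velocity_eq (M.lie ξ).2).imp fun x hx => Subtype.ext hx
  obtain ⟨β, hβ⟩ := hlie η
  let B : (Fin d → ℝ) →ₗ[ℝ] (Fin d → ℝ) →ₗ[ℝ] ℝ := scaForm.compl₁₂ e.velocity e.velocity
  have hB : ∀ x y, B x y = sca (e.toLie x).val (e.toLie y).val := fun x y => rfl
  have hBsymm : ∀ x y, B x y = B y x := fun x y => sca_comm _ _
  have hBβ : B β β = M.q η := by rw [hB, hβ, hq]
  have hw : ∀ k, b.weightForm e k β = b.weight k (M.lie η) := fun k => by
    rw [weightForm_apply, hβ]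
  ext v
  rw [Set.mem_ofPred_eq, mem_optimalClass_iff, coe_q_inv_smul e.commute hsymm hη,
    b.one_le_instab_inv_smul_iff hpos]
  change v ∈ nonnegV ρ (M.lie η) ∧ _ ∈ eigV ρ (M.lie η) 0 ∧ _ ↔ _
  rw [b.mem_nonnegV_iff, ← hq, and_iff_right (Submodule.starProjection_apply_mem _ _)]
  -- Both sides contain the condition that `v` lies in `V^{≥ 0}`. What remains is semistability of
  -- the projection against minimality of the norm, compared through their negations.
  refine and_congr_right fun hS => ?_
  rw [b.zero_mem_closure_iff e hH, not_iff_comm]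
  simp only [b.repr_starProjection hρ, ite_ne_right_iff, ← hq]
  constructor
  -- A strictly shorter admissible `ξ` yields a direction orthogonal to `β` that destabilizes the
  -- projection.
  · intro h
    push Not at h
    obtain ⟨ξ, hξ, hlt⟩ := h
    obtain ⟨y, hy⟩ := hlie ξ
    obtain ⟨x, hx, hpx⟩ := exists_direction_of_lt B hBsymm (fun x => sca_self_nonneg _)
      (α := b.weightForm e) (S := {k | b.basis.repr v k ≠ 0}) (b := β) (y := y) (hBβ ▸ hpos)
      (fun k hk => by
        rw [weightForm_apply, hy]
        exact (b.one_le_instab_iff ξ v).1 hξ k hk)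
      (by rwa [hBβ, hB, hy, ← coe_q e.commute hsymm])
    refine ⟨x, ?_, fun k hk => hpx k hk.2 (by rw [hw, hBβ, hk.1])⟩
    rw [hB, hβ] at hx
    exact hx
  -- A destabilizing direction yields a shorter rational point, which is the Lie vector of some `ξ`
  -- contradicting minimality.
  · rintro ⟨x, hx, hpx⟩ h
    obtain ⟨z, hz, hlt⟩ := exists_rat_lt_of_direction B hBsymm (α := b.weightForm e)
      (S := {k | b.basis.repr v k ≠ 0}) (b := β) (x := x) (hBβ ▸ hpos)
      (fun k hk => by
        rw [hBβ, hw]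
        exact hS k hk)
      (by
        rw [hB, hβ]
        exact hx)
      (fun k hk hkβ => hpx k ⟨by rw [← hw, hkβ, hBβ], hk⟩)
    obtain ⟨ξ, hξ⟩ := e.exists_lie_eq z
    have hξ' : M.lie ξ = e.toLie fun i => (z i : ℝ) := Subtype.ext hξ
    have hle := h ξ ((b.one_le_instab_iff ξ v).2 fun k hk => by
      rw [hξ']
      exact hz k hk)
    rw [coe_q e.commute hsymm ξ, hξ', ← hB, ← hBβ] at hle
    exact absurd hlt (not_lt.2 hle)

end AlgRep.WeightBasis

end Main

end HesselinkStrata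

end

theorem mainTheorem4 {N : ℕ} (A : Subgroup (GL (Fin N) ℝ)) (hA : IsSplitTorus A)
    (hsymm : ∀ X ∈ lieAlg A, Xᵀ = X)
    {V : Type*} [NormedAddCommGroup V] [InnerProductSpace ℝ V] [FiniteDimensional ℝ V]
    (ρ : AlgRep A V) (hρ : ∀ X : lieAlg A, (ρ.diff X).IsSymmetric)
    (η : M A) (β : lieAlg A) (hβ : β = M.lie η) :
    ((M.q η : ℝ) = sca (β : Matrix (Fin N) (Fin N) ℝ) β) ∧
    (η ≠ 0 →
      ((nonnegV ρ β : Set V) = {v | 1 ≤ instab ρ v ((M.q η)⁻¹ • η)}) ∧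
      (∀ r : ℝ, -(M.q η : ℝ) ≤ r → (eigV ρ β r : Set V) \ {0} ⊆
        {v | instab ρ v ((M.q η)⁻¹ • η) = ((1 + r / (M.q η : ℝ) : ℝ) : EReal)}) ∧
      (∀ r : ℝ, r < -(M.q η : ℝ) → (eigV ρ β r : Set V) \ {0} ⊆
        {v | instab ρ v ((M.q η)⁻¹ • η) = ⊥}) ∧
      (∃ H : Subgroup (GL (Fin N) ℝ), IsHBeta A β H) ∧
      (∀ H : Subgroup (GL (Fin N) ℝ), IsHBeta A β H →
        nonnegU ρ β H = {v | (M.q η)⁻¹ • η ∈ optimalClass ρ v})) := by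
  subst hβ
  obtain ⟨d, ⟨e⟩⟩ := hA.exists_chart
  obtain ⟨n, ⟨b⟩⟩ := ρ.exists_weightBasis e.commute hρ
  have hq := coe_q e.commute hsymm η
  refine ⟨hq, fun hη => ?_⟩
  have hpos := coe_q_pos e.commute hsymm hη
  refine ⟨?_, fun r hr v hv => ?_, fun r hr v hv => ?_, e.exists_isHBeta hA.1 hsymm η,
    fun H hH => b.nonnegU_eq e hsymm hρ hη hH⟩
  · ext v
    rw [SetLike.mem_coe, b.mem_nonnegV_iff, Set.mem_ofPred_eq,
      b.one_le_instab_inv_smul_iff hpos, hq]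
  · rw [Set.mem_ofPred_eq, b.instab_of_mem_eigV e.commute hsymm hη hv.1 hv.2, if_neg]
    rw [not_lt, ← neg_le_iff_add_nonneg', le_div_iff₀ hpos]
    linarith
  · rw [Set.mem_ofPred_eq, b.instab_of_mem_eigV e.commute hsymm hη hv.1 hv.2, if_pos]
    rw [← lt_neg_iff_add_neg', div_lt_iff₀ hpos]
    linarith
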